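/- Let $c,k,\nu>0$, and consider on $\mathbb{R}$ the damped pressureless Euler–Poisson system $$\rho_t+(\rho u)_x=0,\qquad u_t+uu_x=-k\phi_x-\nu u,\qquad -\phi_{xx}=\rho-c,$$ with initial data $\rho(0,x)=\rho_0(x)>0$, $u(0,x)=u_0(x)$, where $\rho_0,u_0\in C^1(\mathbb{R})$, the improper integral $\int_{-\infty}^{\infty}(\rho_0-c)\,d\xi$ converges to $0$ (neutrality), and $\rho_0(x)u_0(x)\to0$ as $x\to\pm\infty$. A *solution with continuous density* on $[0,T)\times\mathbb{R}$ ($0\le T\le\infty$) is a pair $(\rho,u)$ attaining the initial data, with $u\in C^1([0,T)\times\mathbb{R})$ and $\rho\in C^0([0,T)\times\mathbb{R})$, for which there is, for each $0<t<T$, a potential $\phi(t,\cdot)\in C^2(\mathbb{R})$ with $\phi_x(t,x)\to0$ as $x\to\pm\infty$, such that the second and third equations hold pointwise for $0<t<T$, and the first holds in the integral form $\frac{d}{dt}\int_a^b\rho\,dx=(\rho u)(t,a)-(\rho u)(t,b)$ for all $a\le b$ and $0<t<T$. It is a *classical solution* if $\rho\in C^1([0,T)\times\mathbb{R})$ and the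 first equation holds pointwise for $0<t<T$ instead. In either class there is *finite time breakdown* if the maximal life span $T^*\in[0,\infty]$ (the supremum of all $T$ for which a solution on $[0,T)\times\mathbb R$ exists in that class) is finite. Then there is finite time breakdown in the class of solutions with continuous density if and only if there is an $x\in\mathbb{R}$ at which the following inequality, for the damping regime at hand, holds. If moreover $u_0\in C^2(\mathbb{R})$, then the same condition is also necessary and sufficient for finite time breakdown in the class of classical solutions. 1. Strong damping, $\nu>2\sqrt{kc}$: with $\lambda_1=\frac{\nu-\sqrt{\nu^2-4kc}}{2c}$ and $\lambda_2=\frac{\nu+\sqrt{\nu^2-4kc}}{2c}$, $$\max\{u_0'(x),\,u_0'(x)+\lambda_2(c-\rho_0(x))\}<0\quad\text{and}\quad\left|\frac{c\lambda_2u_0'(x)+k(c-\rho_0(x))}{k\rho_0(x)}\right|^{\lambda_1}\le\left|\frac{c\lambda_1u_0'(x)+k(c-\rho_0(x))}{k\rho_0(x)}\right|^{\lambda_2}.$$ 2. Borderline damping, $\nu=2\sqrt{kc}$: $$\max\Big\{u_0'(x),\,u_0'(x)+\frac{\nu}{2c}(c-\rho_0(x))\Big\}<0\quad\text{and}\quad\ln\left(-\frac{2cu_0'(x)+\nu(c-\rho_0(x))}{\nu\rho_0(x)}\right)\ge\frac{2cu_0'(x)}{2cu_0'(x)+\nu(c-\rho_0(x))}.$$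 3. Weak damping, $\nu<2\sqrt{kc}$: with $\mu=\sqrt{kc-\nu^2/4}$, $$\left(u_0'(x)+\frac{\nu(c-\rho_0(x))}{2c}\right)^2\ge\mu^2\left[\frac{\rho_0(x)^2}{c^2}\left(\frac{kc\,e^{\nu t^*}}{\mu^2}-1\right)+\frac{2\rho_0(x)-c}{c}\right],$$ where $$t^*=\frac1\mu\left[\beta+\tan^{-1}\left(\frac{2\mu u_0'(x)}{\nu u_0'(x)+2k(c-\rho_0(x))}\right)\right],\qquad\beta=\begin{cases}0,&\nu u_0'(x)<\min\{0,2k(\rho_0(x)-c)\},\\ \pi,&2k(\rho_0(x)-c)\le\nu u_0'(x),\\ 2\pi,&0\le\nu u_0'(x)<2k(\rho_0(x)-c),\end{cases}$$ and where, if the denominator $\nu u_0'(x)+2k(c-\rho_0(x))$ is $0$, the value of $\tan^{-1}$ is taken to be $\frac\pi2\operatorname{sgn}(u_0'(x))$ (with $\operatorname{sgn}0=0$). -/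

import Mathlib

open Filter Topology
open scoped ENNReal

noncomputable section

namespace EulerPoisson

/-- The space-time slab `[0, T) × ℝ` (points are pairs `(t, x)`), with `0 ≤ T ≤ ∞`. -/
def slab (T : ℝ≥0∞) : Set (ℝ × ℝ) :=
  {p | 0 ≤ p.1 ∧ ENNReal.ofReal p.1 < T}

/-- Neutrality `∫_{-∞}^{∞} (ρ₀ - c) dξ = 0`, the integral being read as a (possibly only
conditionally convergent) improper integral. -/
def Neutral (c : ℝ) (ρ₀ : ℝ → ℝ) : Prop :=
  Tendsto (fun p : ℝ × ℝ => ∫ ξ in p.1..p.2, (ρ₀ ξ - c)) (atBot ×ˢ atTop) (𝓝 0)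

/-- The flux `ρ₀ u₀` vanishes at `x → ±∞`. -/
def VanishingFlux (ρ₀ u₀ : ℝ → ℝ) : Prop :=
  Tendsto (fun x => ρ₀ x * u₀ x) atTop (𝓝 0) ∧ Tendsto (fun x => ρ₀ x * u₀ x) atBot (𝓝 0)

/-- The part of the notion of a solution on `[0, T) × ℝ` that does not involve the continuity
equation: `u` is `C¹` up to `t = 0`, the initial data are attained, and there is a potential `φ`,
`C²` in `x`, with `-φ_xx = ρ - c`, with `u_t + u u_x = -k φ_x - ν u`, and whose field `φ_x`
vanishes at `x → ±∞` (this is neutrality at the time `t`, and it fixes the field). -/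
structure IsMomentumSolution (c k ν : ℝ) (ρ₀ u₀ : ℝ → ℝ) (T : ℝ≥0∞) (ρ u : ℝ → ℝ → ℝ) :
    Prop where
  velocity_contDiffOn : ContDiffOn ℝ 1 (fun p : ℝ × ℝ => u p.1 p.2) (slab T)
  initial_density : ∀ x, ρ 0 x = ρ₀ x
  initial_velocity : ∀ x, u 0 x = u₀ x
  exists_potential : ∃ φ : ℝ → ℝ → ℝ, ∀ t : ℝ, 0 < t → ENNReal.ofReal t < T →
    ContDiff ℝ 2 (φ t) ∧
    Tendsto (deriv (φ t)) atTop (𝓝 0) ∧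
    Tendsto (deriv (φ t)) atBot (𝓝 0) ∧
    ∀ x : ℝ,
      -deriv (deriv (φ t)) x = ρ t x - c ∧
      deriv (fun τ => u τ x) t + u t x * deriv (fun y => u t y) x
        = -k * deriv (φ t) x - ν * u t x

/-- Classical solution on `[0, T) × ℝ`: `ρ` and `u` are `C¹` up to `t = 0` and
`ρ_t + (ρ u)_x = 0` holds pointwise, in addition to the momentum and Poisson equations. -/
structure IsClassicalSolution (c k ν : ℝ) (ρ₀ u₀ : ℝ → ℝ) (T : ℝ≥0∞) (ρ u : ℝ → ℝ → ℝ) :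
    Prop extends IsMomentumSolution c k ν ρ₀ u₀ T ρ u where
  density_contDiffOn : ContDiffOn ℝ 1 (fun p : ℝ × ℝ => ρ p.1 p.2) (slab T)
  continuity_equation : ∀ t : ℝ, 0 < t → ENNReal.ofReal t < T → ∀ x : ℝ,
    deriv (fun τ => ρ τ x) t + deriv (fun y => ρ t y * u t y) x = 0

/-- Solution with merely continuous density: `u` is `C¹`, `ρ` is continuous, and the conservation
law `ρ_t + (ρ u)_x = 0` holds in integral form on every interval `[a, b]`. -/
structure IsContinuousSolution (c k ν : ℝ) (ρ₀ u₀ : ℝ → ℝ) (T : ℝ≥0∞) (ρ u : ℝ → ℝ → ℝ) :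
    Prop extends IsMomentumSolution c k ν ρ₀ u₀ T ρ u where
  density_continuousOn : ContinuousOn (fun p : ℝ × ℝ => ρ p.1 p.2) (slab T)
  mass_balance : ∀ t : ℝ, 0 < t → ENNReal.ofReal t < T → ∀ a b : ℝ, a ≤ b →
    HasDerivAt (fun τ => ∫ x in a..b, ρ τ x) (ρ t a * u t a - ρ t b * u t b) t

/-- Maximal life span, in `[0, ∞]`, within the class of classical solutions. -/
def classicalLifespan (c k ν : ℝ) (ρ₀ u₀ : ℝ → ℝ) : ℝ≥0∞ :=
  sSup {T | ∃ ρ u : ℝ → ℝ → ℝ, IsClassicalSolution c k ν ρ₀ u₀ T ρ u}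

/-- Maximal life span, in `[0, ∞]`, within the class of solutions with continuous density. -/
def continuousLifespan (c k ν : ℝ) (ρ₀ u₀ : ℝ → ℝ) : ℝ≥0∞ :=
  sSup {T | ∃ ρ u : ℝ → ℝ → ℝ, IsContinuousSolution c k ν ρ₀ u₀ T ρ u}

def lam₁ (c k ν : ℝ) : ℝ := (ν - √(ν ^ 2 - 4 * k * c)) / (2 * c)

def lam₂ (c k ν : ℝ) : ℝ := (ν + √(ν ^ 2 - 4 * k * c)) / (2 * c)

/-- The inequality for strong damping, at density `r = ρ₀(x)` and slope `d = u₀'(x)`. -/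
def StrongCondition (c k ν r d : ℝ) : Prop :=
  max d (d + lam₂ c k ν * (c - r)) < 0 ∧
  |(c * lam₂ c k ν * d + k * (c - r)) / (k * r)| ^ lam₁ c k ν
    ≤ |(c * lam₁ c k ν * d + k * (c - r)) / (k * r)| ^ lam₂ c k ν

/-- The inequality for borderline damping. -/
def BorderlineCondition (c ν r d : ℝ) : Prop :=
  max d (d + ν / (2 * c) * (c - r)) < 0 ∧
  Real.log (-((2 * c * d + ν * (c - r)) / (ν * r)))
    ≥ 2 * c * d / (2 * c * d + ν * (c - r))

def dampedFrequency (c k ν : ℝ) : ℝ := √(k * c - ν ^ 2 / 4)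

/-- The shift `β`. Its three branches are `ν d < min {0, 2k(r - c)}`; `2k(r - c) ≤ ν d`; and
`0 ≤ ν d < 2k(r - c)`. (The equality cases are the limiting ones.) -/
def phaseShift (c k ν r d : ℝ) : ℝ :=
  if ν * d < min 0 (2 * k * (r - c)) then 0
  else if 2 * k * (r - c) ≤ ν * d then Real.pi
  else 2 * Real.pi

/-- `tan⁻¹ (2 μ d / (ν d + 2k(c - r)))`, with the value `± π/2` (the sign being that of `d`) when
the denominator vanishes. -/
def phaseAngle (c k ν r d : ℝ) : ℝ :=
  if ν * d + 2 * k * (c - r) = 0 then SignType.sign d * (Real.pi / 2)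
  else Real.arctan (2 * dampedFrequency c k ν * d / (ν * d + 2 * k * (c - r)))

def firstMinTime (c k ν r d : ℝ) : ℝ :=
  1 / dampedFrequency c k ν * (phaseShift c k ν r d + phaseAngle c k ν r d)

/-- The inequality for weak damping. -/
def WeakCondition (c k ν r d : ℝ) : Prop :=
  (d + ν * (c - r) / (2 * c)) ^ 2 ≥
    dampedFrequency c k ν ^ 2 *
      (r ^ 2 / c ^ 2 *
          (k * c * Real.exp (ν * firstMinTime c k ν r d) / dampedFrequency c k ν ^ 2 - 1)
        + (2 * r - c) / c)

/-- The inequality of the damping regime at hand. -/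
def Supercritical (c k ν r d : ℝ) : Prop :=
  (2 * √(k * c) < ν ∧ StrongCondition c k ν r d) ∨
  (ν = 2 * √(k * c) ∧ BorderlineCondition c ν r d) ∨
  (ν < 2 * √(k * c) ∧ WeakCondition c k ν r d)

end EulerPoisson

end

/-! The system is linear in Lagrangian coordinates. Let `m` be the mass coordinate, `∂ₓm = ρ`, `∂ₜm
= -ρu`; it is constant along characteristics. By the Poisson equation the field `E = -φ_x` is `m - c
x + H(t)`, so a characteristic starting at `α` solves the damped oscillator `X'' + ν X' + k c X = k
(m₀(α) + H(t))`. Differentiation in `α` removes the unknown `H`: the factor `Γ = ∂X/∂α` (`stretch`)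
solves an oscillator whose data are only `ρ₀(α)` and `u₀'(α)`. Since `ρ = ρ₀/Γ` along the
characteristic, breakdown should mean exactly that some `Γ` reaches `0` in finite time.

Threshold (`exists_impulseResponse`). As `Γ(0) = 1` and `Γ → ρ₀/c > 0`, it suffices to test `Γ ≤ 0`
at its critical times. These are explicit in each of the three damping regimes, and the test becomes
the stated inequality.

Breakdown (`IsStripSolution.stretch_ne_zero`). For an arbitrary solution, a Gronwall estimate shows
that the explicit oscillator paths are its characteristics. As `u` is locally Lipschitz in `x`,
uniformly up to the final time of a closed strip, two of them can approach at most exponentially,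
which excludes `Γ = 0`. This bounds the lifespan of all solutions by one time.

Global existence (`exists_isGlobalFlow`, `IsGlobalFlow.isMomentumSolution`). If `Γ > 0` always,
neutrality supplies an initial field vanishing at both ends, and the flow built from it with `H = 0`
is increasing. The vanishing flux makes its displacement vanish at infinity, so it is onto. The
inverse function theorem makes its inverse `C¹`, and the Eulerian fields read off from it solve the
system for all time. The density contains `u₀'` through `Γ`, so it is `C¹` when `u₀` is `C²` and
merely continuous in general. -/

namespace EulerPoisson

noncomputable section

/-- `B` (with derivative `B'`) is the impulse response of the damped oscillator
`B'' + ν B' + k c B = 0`. -/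
structure IsImpulseResponse (c k ν : ℝ) (B B' : ℝ → ℝ) : Prop where
  hasDerivAt : ∀ t, HasDerivAt B (B' t) t
  hasDerivAt_deriv : ∀ t, HasDerivAt B' (-ν * B' t - k * c * B t) t
  apply_zero : B 0 = 0
  deriv_zero : B' 0 = 1
  tendsto : Tendsto B atTop (𝓝 0)
  tendsto_deriv : Tendsto B' atTop (𝓝 0)

/-- The factor `∂X/∂α` along a characteristic that starts with density `r` and slope `d`; it solves
`Γ'' + ν Γ' + k c Γ = k r`, `Γ(0) = 1`, `Γ'(0) = d`. -/
def stretch (c ν : ℝ) (B B' : ℝ → ℝ) (r d t : ℝ) : ℝ :=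
  1 + B t * d + (1 - B' t - ν * B t) / c * (r - c)

/-! ### The stretch factor and its critical times -/

namespace IsImpulseResponse

variable {c k ν : ℝ} {B B' : ℝ → ℝ}

theorem stretch_zero (h : IsImpulseResponse c k ν B B') (r d : ℝ) :
    stretch c ν B B' r d 0 = 1 := by
  simp [stretch, h.apply_zero, h.deriv_zero]

theorem hasDerivAt_gain (h : IsImpulseResponse c k ν B B') (hc : c ≠ 0) (t : ℝ) :
    HasDerivAt (fun t => (1 - B' t - ν * B t) / c) (k * B t) t := by
  have := ((((h.hasDerivAt_deriv t).const_sub 1).sub ((h.hasDerivAt t).const_mul ν)).div_const c)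
  convert! this using 1
  field_simp
  ring

theorem hasDerivAt_stretch (h : IsImpulseResponse c k ν B B') (hc : c ≠ 0) (r d t : ℝ) :
    HasDerivAt (stretch c ν B B' r d) (B' t * d + k * B t * (r - c)) t :=
  (((h.hasDerivAt t).mul_const d).const_add 1).add ((h.hasDerivAt_gain hc t).mul_const (r - c))

/-- If the stretch factor becomes nonpositive, it is nonpositive at a critical time. -/
theorem exists_stretch_nonpos_iff (h : IsImpulseResponse c k ν B B') (hc : 0 < c) {r : ℝ}
    (hr : 0 < r) (d : ℝ) :
    (∃ t, 0 ≤ t ∧ stretch c ν B B' r d t ≤ 0) ↔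
      ∃ t, 0 < t ∧ B' t * d + k * B t * (r - c) = 0 ∧ stretch c ν B B' r d t ≤ 0 := by
  refine ⟨?_, fun ⟨t, ht, _, h'⟩ => ⟨t, ht.le, h'⟩⟩
  rintro ⟨t₀, ht₀, hJ⟩
  -- The stretch factor is positive at `0` and in the limit, so a nonpositive minimum over a long
  -- enough compact interval is interior, hence critical.
  have hlim : Tendsto (stretch c ν B B' r d) atTop (𝓝 (r / c)) := by
    have h1 : Tendsto (stretch c ν B B' r d) atTop
        (𝓝 (1 + 0 * d + (1 - 0 - ν * 0) / c * (r - c))) :=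
      ((h.tendsto.mul_const d).const_add 1).add
        ((((h.tendsto_deriv.const_sub 1).sub (h.tendsto.const_mul ν)).div_const c).mul_const _)
    convert h1 using 2
    field_simp
    ring
  obtain ⟨T, hT, hJT⟩ : ∃ T, t₀ < T ∧ 0 < stretch c ν B B' r d T :=
    ((eventually_gt_atTop t₀).and (hlim.eventually_const_lt (by positivity))).exists
  have hcont : Continuous (stretch c ν B B' r d) :=
    continuous_iff_continuousAt.2 fun t => (h.hasDerivAt_stretch hc.ne' r d t).continuousAt
  obtain ⟨t₁, ht₁, hmin⟩ := (isCompact_Icc (a := (0 : ℝ)) (b := T)).exists_isMinOn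
    ⟨t₀, ht₀, hT.le⟩ hcont.continuousOn
  have hJ₁ : stretch c ν B B' r d t₁ ≤ 0 := (hmin ⟨ht₀, hT.le⟩).trans hJ
  have h0 : 0 < t₁ := by
    rcases ht₁.1.eq_or_lt with h0 | h0
    · rw [← h0, h.stretch_zero] at hJ₁
      linarith
    · exact h0
  have hT₁ : t₁ < T := by
    rcases ht₁.2.eq_or_lt with h0 | h0
    · rw [h0] at hJ₁
      linarith
    · exact h0
  exact ⟨t₁, h0, (hmin.isLocalMin (Icc_mem_nhds h0 hT₁)).hasDerivAt_eq_zero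
    (h.hasDerivAt_stretch hc.ne' r d t₁), hJ₁⟩

end IsImpulseResponse

/-! ### Strong damping: two real decay rates -/

section Strong

theorem hasDerivAt_exp_neg_mul (m t : ℝ) :
    HasDerivAt (fun t => Real.exp (-(m * t))) (-(m * Real.exp (-(m * t)))) t := by
  have := (((hasDerivAt_id t).const_mul m).neg).exp
  convert! this using 1
  simp
  ring

theorem tendsto_exp_neg_mul {m : ℝ} (hm : 0 < m) :
    Tendsto (fun t => Real.exp (-(m * t))) atTop (𝓝 0) :=
  Real.tendsto_exp_atBot.comp (tendsto_neg_atTop_atBot.comp (tendsto_id.const_mul_atTop hm))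

theorem isImpulseResponse_overdamped {c k ν m₁ m₂ : ℝ} (h₁ : 0 < m₁) (h₁₂ : m₁ < m₂)
    (hsum : m₁ + m₂ = ν) (hprod : m₁ * m₂ = k * c) :
    IsImpulseResponse c k ν
      (fun t => (Real.exp (-(m₁ * t)) - Real.exp (-(m₂ * t))) / (m₂ - m₁))
      (fun t => (m₂ * Real.exp (-(m₂ * t)) - m₁ * Real.exp (-(m₁ * t))) / (m₂ - m₁)) where
  hasDerivAt t := by
    convert! ((hasDerivAt_exp_neg_mul m₁ t).sub (hasDerivAt_exp_neg_mul m₂ t)).div_const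
      (m₂ - m₁) using 1
    ring
  hasDerivAt_deriv t := by
    convert! (((hasDerivAt_exp_neg_mul m₂ t).const_mul m₂).sub
      ((hasDerivAt_exp_neg_mul m₁ t).const_mul m₁)).div_const (m₂ - m₁) using 1
    rw [← hsum, ← hprod]
    ring
  apply_zero := by simp
  deriv_zero := by
    have : m₂ - m₁ ≠ 0 := by linarith
    simp [this]
  tendsto := by
    simpa using ((tendsto_exp_neg_mul h₁).sub
      (tendsto_exp_neg_mul (h₁.trans h₁₂))).div_const (m₂ - m₁)
  tendsto_deriv := by
    simpa using (((tendsto_exp_neg_mul (h₁.trans h₁₂)).const_mul m₂).sub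
      ((tendsto_exp_neg_mul h₁).const_mul m₁)).div_const (m₂ - m₁)

/-- A critical time satisfies `N₂ e^{-c l₂ t} = N₁ e^{-c l₁ t}`, and the value there is `(k r + N₁
e^{-c l₁ t}) / (k c)`, so nonpositivity forces `N₁ < 0`. Write `-N₁/(k r) = e^a` and `-N₂/(k r) =
e^b`. Then `t = (b - a)/(c l₂ - c l₁)`, its positivity is `d < 0`, and the value is nonpositive iff
`c l₁ t ≤ a`, that is `b l₁ ≤ a l₂`: the inequality of powers. -/
theorem exists_stretch_nonpos_iff_overdamped {c k ν l₁ l₂ r d : ℝ} (hc : 0 < c) (hk : 0 < k)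
    (h₁ : 0 < l₁) (h₁₂ : l₁ < l₂) (hsum : c * l₁ + c * l₂ = ν) (hprod : c * l₁ * l₂ = k)
    (hr : 0 < r) {B B' : ℝ → ℝ}
    (hB : B = fun t => (Real.exp (-(c * l₁ * t)) - Real.exp (-(c * l₂ * t))) / (c * l₂ - c * l₁))
    (hB' : B' = fun t => (c * l₂ * Real.exp (-(c * l₂ * t)) - c * l₁ * Real.exp (-(c * l₁ * t)))
      / (c * l₂ - c * l₁)) :
    (∃ t, 0 < t ∧ B' t * d + k * B t * (r - c) = 0 ∧ stretch c ν B B' r d t ≤ 0) ↔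
      max d (d + l₂ * (c - r)) < 0 ∧
      |(c * l₂ * d + k * (c - r)) / (k * r)| ^ l₁ ≤
        |(c * l₁ * d + k * (c - r)) / (k * r)| ^ l₂ := by
  set N₁ := c * l₁ * d + k * (c - r) with hN₁
  set N₂ := c * l₂ * d + k * (c - r) with hN₂
  have hδ : 0 < c * l₂ - c * l₁ := by nlinarith
  have hkr : 0 < k * r := by positivity
  have hN₁' : N₁ = c * l₁ * (d + l₂ * (c - r)) := by rw [hN₁, ← hprod]; ring
  have hNd : N₂ - N₁ = (c * l₂ - c * l₁) * d := by rw [hN₁, hN₂]; ring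
  have hslope : ∀ t, B' t * d + k * B t * (r - c) =
      (N₂ * Real.exp (-(c * l₂ * t)) - N₁ * Real.exp (-(c * l₁ * t))) / (c * l₂ - c * l₁) := by
    intro t
    rw [hB, hB', hN₁, hN₂]
    ring
  clear_value N₁ N₂
  have hval : ∀ t, N₂ * Real.exp (-(c * l₂ * t)) = N₁ * Real.exp (-(c * l₁ * t)) →
      stretch c ν B B' r d t = (k * r + N₁ * Real.exp (-(c * l₁ * t))) / (k * c) := by
    intro t ht
    simp only [stretch, hB, hB', ← hsum]
    generalize Real.exp (-(c * l₂ * t)) = e₂ at *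
    generalize Real.exp (-(c * l₁ * t)) = e₁ at *
    have h3 : l₂ - l₁ ≠ 0 := by linarith
    rw [← mul_sub]
    have : c ≠ 0 := hc.ne'
    have : k ≠ 0 := hk.ne'
    field_simp
    rw [hN₁, hN₂, ← hprod] at ht
    rw [hN₁, ← hprod]
    have hcl : c * l₁ ≠ 0 := by positivity
    linear_combination (-l₁) * ht
  constructor
  · rintro ⟨t, ht, hslope0, hJ⟩
    rw [hslope, div_eq_zero_iff, or_iff_left hδ.ne', sub_eq_zero] at hslope0
    rw [hval t hslope0, div_le_iff₀ (by positivity), zero_mul] at hJ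
    have hN₂e : N₂ = N₁ * Real.exp ((c * l₂ - c * l₁) * t) := by
      have : N₂ = N₂ * Real.exp (-(c * l₂ * t)) * Real.exp (c * l₂ * t) := by
        rw [mul_assoc, ← Real.exp_add]; simp
      rw [this, hslope0, mul_assoc, ← Real.exp_add]
      ring_nf
    have hN₁neg : N₁ < 0 := by
      by_contra hcon
      have := mul_nonneg (not_lt.1 hcon) (Real.exp_pos (-(c * l₁ * t))).le
      linarith
    have hgt : 1 < Real.exp ((c * l₂ - c * l₁) * t) := Real.one_lt_exp_iff.2 (by positivity)
    have hd : d < 0 := by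
      have : (c * l₂ - c * l₁) * d < 0 := by rw [← hNd, hN₂e]; nlinarith
      by_contra hcon
      have := mul_nonneg hδ.le (not_lt.1 hcon)
      linarith
    have hs : d + l₂ * (c - r) < 0 := by
      by_contra hcon
      have : 0 ≤ N₁ := by
        rw [hN₁']
        have := not_lt.1 hcon
        positivity
      linarith
    refine ⟨max_lt hd hs, ?_⟩
    obtain ⟨a, ha⟩ : ∃ a, Real.exp a = -N₁ / (k * r) :=
      ⟨_, Real.exp_log (div_pos (by linarith) hkr)⟩
    have hab₁ : |N₁ / (k * r)| = Real.exp a := by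
      rw [abs_of_neg (div_neg_of_neg_of_pos hN₁neg hkr), ha, neg_div]
    have hab₂ : |N₂ / (k * r)| = Real.exp (a + (c * l₂ - c * l₁) * t) := by
      rw [hN₂e, mul_div_right_comm, abs_mul, hab₁, abs_of_pos (Real.exp_pos _), ← Real.exp_add]
    have hat : c * l₁ * t ≤ a := by
      rw [← Real.exp_le_exp, ha, le_div_iff₀ hkr]
      have h4 : Real.exp (c * l₁ * t) * Real.exp (-(c * l₁ * t)) = 1 := by
        rw [← Real.exp_add]; simp
      have h5 := mul_le_mul_of_nonneg_left hJ (Real.exp_pos (c * l₁ * t)).le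
      linear_combination h5 - N₁ * h4
    rw [hab₁, hab₂, ← Real.exp_mul, ← Real.exp_mul, Real.exp_le_exp]
    nlinarith [mul_le_mul_of_nonneg_left hat (sub_pos.2 h₁₂).le]
  · rintro ⟨hmax, hpow⟩
    obtain ⟨hd, hs⟩ := max_lt_iff.1 hmax
    have hN₁neg : N₁ < 0 := by
      rw [hN₁']
      exact mul_neg_of_pos_of_neg (by positivity) hs
    have hlt : N₂ < N₁ := by
      have := mul_neg_of_pos_of_neg hδ hd
      linarith
    obtain ⟨a, ha⟩ : ∃ a, Real.exp a = -N₁ / (k * r) :=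
      ⟨_, Real.exp_log (div_pos (by linarith) hkr)⟩
    obtain ⟨b, hb⟩ : ∃ b, Real.exp b = -N₂ / (k * r) :=
      ⟨_, Real.exp_log (div_pos (by linarith) hkr)⟩
    have hab : a < b := by
      rw [← Real.exp_lt_exp, ha, hb]
      gcongr
    rw [abs_of_neg (div_neg_of_neg_of_pos hN₁neg hkr),
      abs_of_neg (div_neg_of_neg_of_pos (hlt.trans hN₁neg) hkr), ← neg_div, ← neg_div, ← ha, ← hb,
      ← Real.exp_mul, ← Real.exp_mul, Real.exp_le_exp] at hpow
    have hN₁e : N₁ = -(k * r * Real.exp a) := by rw [ha]; field_simp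
    have hN₂e : N₂ = -(k * r * Real.exp b) := by rw [hb]; field_simp
    have ht : (c * l₂ - c * l₁) * ((b - a) / (c * l₂ - c * l₁)) = b - a :=
      mul_div_cancel₀ _ hδ.ne'
    set t := (b - a) / (c * l₂ - c * l₁)
    have hcrit : N₂ * Real.exp (-(c * l₂ * t)) = N₁ * Real.exp (-(c * l₁ * t)) := by
      rw [hN₁e, hN₂e, neg_mul, neg_mul, mul_assoc (k * r), mul_assoc (k * r), ← Real.exp_add,
        ← Real.exp_add]
      have : b + -(c * l₂ * t) = a + -(c * l₁ * t) := by linarith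
      rw [this]
    refine ⟨t, div_pos (sub_pos.2 hab) hδ, ?_, ?_⟩
    · rw [hslope, hcrit, sub_self, zero_div]
    · rw [hval t hcrit, div_le_iff₀ (by positivity), zero_mul, hN₁e, neg_mul, mul_assoc,
        ← Real.exp_add]
      have h6 : 0 ≤ a + -(c * l₁ * t) := by
        have h7 : (c * l₂ - c * l₁) * (a + -(c * l₁ * t)) = c * (a * l₂ - b * l₁) := by
          linear_combination -(c * l₁) * ht
        refine nonneg_of_mul_nonneg_right (a := c * l₂ - c * l₁) ?_ hδ
        rw [h7]
        exact mul_nonneg hc.le (sub_nonneg.2 hpow)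
      nlinarith [Real.one_le_exp h6]

end Strong

/-! ### Borderline damping: a double decay rate -/

section Borderline

theorem isImpulseResponse_critical {c k ν m : ℝ} (hm : 0 < m) (hν : ν = 2 * m)
    (hkc : k * c = m ^ 2) :
    IsImpulseResponse c k ν (fun t => t * Real.exp (-(m * t)))
      (fun t => (1 - m * t) * Real.exp (-(m * t))) := by
  have hlim : Tendsto (fun t => t * Real.exp (-(m * t))) atTop (𝓝 0) := by
    have h1 := ((Real.tendsto_pow_mul_exp_neg_atTop_nhds_zero 1).comp
      (tendsto_id.const_mul_atTop hm)).const_mul m⁻¹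
    refine (h1.congr fun t => ?_).trans (by simp)
    simp only [Function.comp, id, pow_one]
    field_simp
  refine ⟨fun t => ?_, fun t => ?_, by simp, by simp, hlim, ?_⟩
  · convert! (hasDerivAt_id t).mul (hasDerivAt_exp_neg_mul m t) using 1
    simp
    ring
  · convert! (((hasDerivAt_id t).const_mul m).const_sub 1).mul (hasDerivAt_exp_neg_mul m t) using 1
    simp only [id, hν, hkc]
    ring
  · have := (tendsto_exp_neg_mul hm).sub (hlim.const_mul m)
    simp only [mul_zero, sub_zero] at this
    exact this.congr fun t => by ring

/-- The slope is `e^{-m t} (d - m s t)`, so when `s < 0` the only critical time is `t = d/(m s)`,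
positive iff `d < 0`. The value there is `(m r + c s e^{-m t}) / (m c)`; it is nonpositive iff `e^{m
t} ≤ -c s/(m r)`, and the logarithm of this is the stated inequality. -/
theorem exists_stretch_nonpos_iff_critical {c k ν m r d : ℝ} (hc : 0 < c) (hm : 0 < m)
    (hν : ν = 2 * m) (hkc : k * c = m ^ 2) (hr : 0 < r) {B B' : ℝ → ℝ}
    (hB : B = fun t => t * Real.exp (-(m * t)))
    (hB' : B' = fun t => (1 - m * t) * Real.exp (-(m * t))) :
    (∃ t, 0 < t ∧ B' t * d + k * B t * (r - c) = 0 ∧ stretch c ν B B' r d t ≤ 0) ↔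
      BorderlineCondition c ν r d := by
  have hQ : 2 * c * d + ν * (c - r) = 2 * c * (d + ν / (2 * c) * (c - r)) := by
    field_simp
  unfold BorderlineCondition
  rw [hQ]
  set s := d + ν / (2 * c) * (c - r) with hs
  have hs' : c * s = c * d + m * (c - r) := by rw [hs, hν]; field_simp
  clear_value s
  have hslope : ∀ t, B' t * d + k * B t * (r - c) = Real.exp (-(m * t)) * (d - m * s * t) := by
    intro t
    have h1 : k * (r - c) = m * d - m * s := by
      apply mul_left_cancel₀ hc.ne'
      linear_combination (r - c) * hkc + m * hs'
    simp only [hB, hB']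
    linear_combination (t * Real.exp (-(m * t))) * h1
  have hval : ∀ t, d = m * s * t →
      stretch c ν B B' r d t = (m * r + c * s * Real.exp (-(m * t))) / (m * c) := by
    intro t ht
    simp only [stretch, hB, hB', hν]
    generalize Real.exp (-(m * t)) = e
    field_simp
    linear_combination (-e - m * t * e) * hs' - c * e * ht
  constructor
  · rintro ⟨t, ht, h0, hJ⟩
    rw [hslope, mul_eq_zero, or_iff_right (Real.exp_pos _).ne', sub_eq_zero] at h0
    rw [hval t h0, div_le_iff₀ (by positivity), zero_mul] at hJ
    have hsneg : s < 0 := by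
      by_contra hcon
      have := mul_nonneg (mul_nonneg hc.le (not_lt.1 hcon)) (Real.exp_pos (-(m * t))).le
      have := mul_pos hm hr
      linarith
    have hd : d < 0 := by
      rw [h0]
      have := mul_pos (mul_pos hm ht) (neg_pos.2 hsneg)
      linarith
    refine ⟨max_lt hd hsneg, ?_⟩
    have h1 : 2 * c * d / (2 * c * s) = m * t := by
      rw [h0]
      have := hsneg.ne
      field_simp
    rw [h1, ge_iff_le, Real.le_log_iff_exp_le, ← neg_div, hν, le_div_iff₀ (by positivity)]
    · have h4 : Real.exp (m * t) * Real.exp (-(m * t)) = 1 := by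
        rw [← Real.exp_add]; simp
      have h5 := mul_le_mul_of_nonneg_left hJ (Real.exp_pos (m * t)).le
      linear_combination 2 * h5 - 2 * c * s * h4
    · rw [← neg_div, hν]
      have : 0 < -s := neg_pos.2 hsneg
      rw [← mul_neg]
      positivity
  · rintro ⟨hmax, hlog⟩
    obtain ⟨hd, hsneg⟩ := max_lt_iff.1 hmax
    have hns : 0 < -s := neg_pos.2 hsneg
    have hnd : 0 < -d := neg_pos.2 hd
    have hs0 := hsneg.ne
    have ht : d = m * s * (-d / (m * -s)) := by
      field_simp
    have h1 : 2 * c * d / (2 * c * s) = m * (-d / (m * -s)) := by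
      field_simp
    have htpos : 0 < -d / (m * -s) := by positivity
    set t := -d / (m * -s)
    refine ⟨t, htpos, ?_, ?_⟩
    · rw [hslope, ← ht, sub_self, mul_zero]
    · rw [hval t ht, div_le_iff₀ (by positivity), zero_mul]
      rw [h1, ge_iff_le, Real.le_log_iff_exp_le, ← neg_div, hν, le_div_iff₀ (by positivity)] at hlog
      · have h4 : Real.exp (-(m * t)) * Real.exp (m * t) = 1 := by
          rw [← Real.exp_add]; simp
        have h5 := mul_le_mul_of_nonneg_left hlog (Real.exp_pos (-(m * t))).le
        linear_combination h5 / 2 - m * r * h4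
      · rw [← neg_div, hν, ← mul_neg]
        positivity

end Borderline

/-! ### Weak damping: oscillation -/

section Weak

theorem isImpulseResponse_underdamped {c k ν μ : ℝ} (hν : 0 < ν) (hμ : 0 < μ)
    (hkc : k * c = μ ^ 2 + ν ^ 2 / 4) :
    IsImpulseResponse c k ν (fun t => Real.exp (-(ν / 2 * t)) * (Real.sin (μ * t) / μ))
      (fun t => Real.exp (-(ν / 2 * t)) *
        (Real.cos (μ * t) - ν / (2 * μ) * Real.sin (μ * t))) := by
  have hsin : ∀ t, HasDerivAt (fun t => Real.sin (μ * t)) (μ * Real.cos (μ * t)) t := fun t => by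
    have := ((hasDerivAt_id t).const_mul μ).sin
    convert! this using 1
    simp [mul_comm]
  have hcos : ∀ t, HasDerivAt (fun t => Real.cos (μ * t)) (-(μ * Real.sin (μ * t))) t := fun t => by
    have := ((hasDerivAt_id t).const_mul μ).cos
    convert! this using 1
    simp [mul_comm]
  have hbdd : ∀ (f : ℝ → ℝ) (M : ℝ), (∀ t, |f t| ≤ M) →
      Tendsto (fun t => Real.exp (-(ν / 2 * t)) * f t) atTop (𝓝 0) := by
    intro f M hM
    have h0 := (tendsto_exp_neg_mul (half_pos hν)).mul_const M
    rw [zero_mul] at h0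
    refine squeeze_zero_norm (fun t => ?_) h0
    rw [norm_mul, Real.norm_eq_abs, Real.norm_eq_abs, abs_of_pos (Real.exp_pos _)]
    exact mul_le_mul_of_nonneg_left (hM t) (Real.exp_pos _).le
  refine ⟨fun t => ?_, fun t => ?_, by simp, by simp, hbdd _ (1 / μ) fun t => ?_,
    hbdd _ (1 + ν / (2 * μ)) fun t => ?_⟩
  · convert! (hasDerivAt_exp_neg_mul (ν / 2) t).mul ((hsin t).div_const μ) using 1
    field_simp
    ring
  · convert! (hasDerivAt_exp_neg_mul (ν / 2) t).mul
      ((hcos t).sub ((hsin t).const_mul (ν / (2 * μ)))) using 1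
    simp only [Pi.sub_apply]
    rw [hkc]
    field_simp
    ring
  · rw [abs_div, abs_of_pos hμ]
    gcongr
    exact Real.abs_sin_le_one _
  · refine (abs_sub _ _).trans (add_le_add (Real.abs_cos_le_one _) ?_)
    rw [abs_mul, abs_of_pos (by positivity : 0 < ν / (2 * μ))]
    exact mul_le_of_le_one_right (by positivity) (Real.abs_sin_le_one _)

/-- The phase `μ t*` of the first minimum: it lies in `(0, 2π]`, and there the vector `(d, g)` is a
nonpositive multiple of `(sin, cos)`. -/
theorem phase_spec {c k ν r d : ℝ} (hν : 0 < ν) (hμ : 0 < dampedFrequency c k ν) :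
    0 < phaseShift c k ν r d + phaseAngle c k ν r d ∧
    phaseShift c k ν r d + phaseAngle c k ν r d ≤ 2 * Real.pi ∧
    ∃ κ ≤ 0, d = κ * Real.sin (phaseShift c k ν r d + phaseAngle c k ν r d) ∧
      (ν * d + 2 * k * (c - r)) / (2 * dampedFrequency c k ν)
        = κ * Real.cos (phaseShift c k ν r d + phaseAngle c k ν r d) := by
  unfold phaseShift phaseAngle
  generalize dampedFrequency c k ν = μ at *
  have hswap : 2 * k * (r - c) = ν * d - (ν * d + 2 * k * (c - r)) := by ring
  rw [hswap]
  generalize ν * d + 2 * k * (c - r) = D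
  have hpi := Real.pi_pos
  by_cases h0 : D = 0
  · subst h0
    simp only [sub_zero, if_true, le_refl, zero_div]
    rw [if_neg (by simp)]
    rcases lt_trichotomy d 0 with hd | hd | hd
    · rw [sign_neg hd]
      have : Real.pi + ((-1 : SignType) : ℝ) * (Real.pi / 2) = Real.pi / 2 := by
        simp; ring
      rw [this]
      exact ⟨by positivity, by linarith, d, hd.le, by simp, by simp⟩
    · subst hd
      rw [sign_zero]
      refine ⟨by simp [hpi], by simp; linarith, 0, le_rfl, by simp, by simp⟩
    · rw [sign_pos hd]
      have : Real.pi + ((1 : SignType) : ℝ) * (Real.pi / 2) = Real.pi / 2 + Real.pi := by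
        simp; ring
      rw [this, Real.sin_add_pi, Real.cos_add_pi]
      exact ⟨by positivity, by linarith, -d, by linarith, by simp, by simp⟩
  · rw [if_neg h0]
    have hg : D / (2 * μ) ≠ 0 := by positivity
    have harg : 2 * μ * d / D = d / (D / (2 * μ)) := by field_simp
    have hgD : 0 < D / (2 * μ) ↔ 0 < D := by
      rw [div_pos_iff_of_pos_right (by positivity)]
    have hgD' : D / (2 * μ) < 0 ↔ D < 0 := by
      rw [div_lt_iff₀ (by positivity), zero_mul]
    rw [harg]
    generalize D / (2 * μ) = g at *
    have hlt := Real.arctan_lt_pi_div_two (d / g)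
    have hgt := Real.neg_pi_div_two_lt_arctan (d / g)
    have hcospos : 0 < Real.cos (Real.arctan (d / g)) := Real.cos_arctan_pos _
    have hsign' : d / g ≤ 0 → Real.arctan (d / g) ≤ 0 := fun h => by
      simpa using Real.arctan_le_arctan_iff.2 h
    have hsign'' : 0 < d / g → 0 < Real.arctan (d / g) := Real.arctan_pos.2
    have htan : d = g / Real.cos (Real.arctan (d / g)) * Real.sin (Real.arctan (d / g)) := by
      have := Real.tan_arctan (d / g)
      rw [Real.tan_eq_sin_div_cos, div_eq_div_iff hcospos.ne' hg] at this
      field_simp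
      linarith
    have hgc : g = g / Real.cos (Real.arctan (d / g)) * Real.cos (Real.arctan (d / g)) := by
      field_simp
    generalize Real.arctan (d / g) = φ at *
    -- The phase must put `(sin, cos)` opposite to `(d, g)`. For `d, g < 0` it lies in `(0, π/2)`,
    -- for `g > 0` in `(π/2, 3π/2)`, and for `g < 0 ≤ d` in `(3π/2, 2π]`; the last interval ends at
    -- `2π` instead of starting at `0` because the time has to be positive.
    split_ifs with h1 h2
    · have hd : d < 0 := by
        have := h1.trans_le (min_le_left _ _)
        by_contra hcon
        have := mul_nonneg hν.le (not_lt.1 hcon)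
        linarith
      have hDn : D < 0 := by
        have := h1.trans_le (min_le_right _ _)
        linarith
      have hgn := hgD'.2 hDn
      refine ⟨by simpa using hsign'' (div_pos_of_neg_of_neg hd hgn), by linarith,
        g / Real.cos φ, div_nonpos_of_nonpos_of_nonneg hgn.le hcospos.le, ?_, ?_⟩
      · rw [zero_add]; exact htan
      · rw [zero_add]; exact hgc
    · have hDp : 0 < D := lt_of_le_of_ne (by linarith) (Ne.symm h0)
      have hgp := hgD.2 hDp
      refine ⟨by linarith, by linarith, -(g / Real.cos φ), by
        have := div_pos hgp hcospos
        linarith, ?_, ?_⟩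
      · rw [add_comm, Real.sin_add_pi, neg_mul_neg]; exact htan
      · rw [add_comm, Real.cos_add_pi, neg_mul_neg]; exact hgc
    · have hDn : D < 0 := by linarith
      have hgn := hgD'.2 hDn
      have hd : 0 ≤ d := by
        by_contra hcon
        apply h1
        rw [lt_min_iff]
        exact ⟨mul_neg_of_pos_of_neg hν (not_le.1 hcon), by linarith⟩
      have := hsign' (div_nonpos_of_nonneg_of_nonpos hd hgn.le)
      refine ⟨by linarith, by linarith,
        g / Real.cos φ, div_nonpos_of_nonpos_of_nonneg hgn.le hcospos.le, ?_, ?_⟩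
      · rw [add_comm, Real.sin_add_two_pi]; exact htan
      · rw [add_comm, Real.cos_add_two_pi]; exact hgc

/-- At a critical time `(d, g) = η (sin μt, cos μt)` and the value is `(k r + μ η e^{-νt/2}) / (k
c)`. Nonpositivity forces `η < 0`, hence `η = κ = -√(d² + g²)` and `μ t = θ + 2πn` with `n ≥ 0`. The
requirement `k r e^{νt/2} ≤ -μ κ` becomes harder as `t` grows, so only the first such time `θ/μ`
matters. -/
theorem exists_stretch_nonpos_iff_underdamped {c k ν r d : ℝ} (hc : 0 < c) (hk : 0 < k)
    (hν : 0 < ν) (hμ : 0 < dampedFrequency c k ν)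
    (hkc : k * c = dampedFrequency c k ν ^ 2 + ν ^ 2 / 4) (hr : 0 < r) {B B' : ℝ → ℝ}
    (hB : B = fun t => Real.exp (-(ν / 2 * t)) *
      (Real.sin (dampedFrequency c k ν * t) / dampedFrequency c k ν))
    (hB' : B' = fun t => Real.exp (-(ν / 2 * t)) * (Real.cos (dampedFrequency c k ν * t) -
      ν / (2 * dampedFrequency c k ν) * Real.sin (dampedFrequency c k ν * t))) :
    (∃ t, 0 < t ∧ B' t * d + k * B t * (r - c) = 0 ∧ stretch c ν B B' r d t ≤ 0) ↔
      WeakCondition c k ν r d := by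
  obtain ⟨hθ0, hθ2, κ, hκ, hκd, hκg⟩ := phase_spec (c := c) (k := k) (r := r) (d := d) hν hμ
  unfold WeakCondition firstMinTime
  rw [one_div_mul_eq_div]
  generalize phaseShift c k ν r d + phaseAngle c k ν r d = θ at *
  generalize dampedFrequency c k ν = μ at *
  set g := (ν * d + 2 * k * (c - r)) / (2 * μ) with hg
  have hg' : 2 * μ * g = ν * d + 2 * k * (c - r) := by rw [hg]; field_simp
  have hκsq : κ ^ 2 = d ^ 2 + g ^ 2 := by
    rw [hκg, hκd]
    linear_combination -κ ^ 2 * Real.sin_sq_add_cos_sq θ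
  have hslope : ∀ t, B' t * d + k * B t * (r - c) =
      Real.exp (-(ν / 2 * t)) * (d * Real.cos (μ * t) - g * Real.sin (μ * t)) := by
    intro t
    rw [hB, hB', hg]
    field_simp
    ring
  have hval : ∀ t η, d = η * Real.sin (μ * t) → g = η * Real.cos (μ * t) →
      stretch c ν B B' r d t = (k * r + μ * η * Real.exp (-(ν / 2 * t))) / (k * c) := by
    intro t η h1 h2
    have hη : η = d * Real.sin (μ * t) + g * Real.cos (μ * t) := by
      rw [h1, h2]
      linear_combination -η * Real.sin_sq_add_cos_sq (μ * t)
    have h3 : g * Real.sin (μ * t) = d * Real.cos (μ * t) := by rw [h1, h2]; ring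
    simp only [stretch, hB, hB']
    rw [hη]
    generalize Real.exp (-(ν / 2 * t)) = e
    generalize Real.sin (μ * t) = s at *
    generalize Real.cos (μ * t) = C at *
    field_simp
    linear_combination (-(μ * e * C) - ν * e * s / 2) * hg' + 2 * e * s * d * hkc + ν * μ * e * h3
  have hneg : ∀ t η, (k * r + μ * η * Real.exp (-(ν / 2 * t))) / (k * c) ≤ 0 ↔
      k * r * Real.exp (ν / 2 * t) ≤ μ * -η := by
    intro t η
    rw [div_le_iff₀ (by positivity), zero_mul, Real.exp_neg]
    have := Real.exp_pos (ν / 2 * t)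
    generalize Real.exp (ν / 2 * t) = E at *
    rw [← sub_nonneg, ← sub_nonneg (b := k * r * E)]
    have : μ * -η - k * r * E = E * (0 - (k * r + μ * η * E⁻¹)) := by
      field_simp
      ring
    rw [this, mul_nonneg_iff_of_pos_left (by assumption)]
  -- Both sides of `k r E ≤ -μ κ` are nonnegative, and the difference of their squares is `k c`
  -- times the difference of the two sides of the stated inequality.
  have hcond : (d + ν * (c - r) / (2 * c)) ^ 2 ≥ μ ^ 2 * (r ^ 2 / c ^ 2 *
      (k * c * Real.exp (ν * (θ / μ)) / μ ^ 2 - 1) + (2 * r - c) / c) ↔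
      k * r * Real.exp (ν / 2 * (θ / μ)) ≤ μ * -κ := by
    have hE : Real.exp (ν * (θ / μ)) = Real.exp (ν / 2 * (θ / μ)) ^ 2 := by
      rw [← Real.exp_nat_mul]
      congr 1
      push_cast
      ring
    rw [hE]
    have hE0 := Real.exp_pos (ν / 2 * (θ / μ))
    generalize Real.exp (ν / 2 * (θ / μ)) = E at *
    rw [← sq_le_sq₀ (by positivity) (mul_nonneg hμ.le (neg_nonneg.2 hκ)), ge_iff_le, ← sub_nonneg,
      ← sub_nonneg (b := (k * r * E) ^ 2)]
    have : (μ * -κ) ^ 2 - (k * r * E) ^ 2 = k * c * ((d + ν * (c - r) / (2 * c)) ^ 2 - μ ^ 2 *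
        (r ^ 2 / c ^ 2 * (k * c * E ^ 2 / μ ^ 2 - 1) + (2 * r - c) / c)) := by
      have h4 : (μ * -κ) ^ 2 = μ ^ 2 * d ^ 2 + (ν * d / 2 + k * (c - r)) ^ 2 := by
        have : μ * g = ν * d / 2 + k * (c - r) := by linarith
        rw [← this]
        linear_combination μ ^ 2 * hκsq
      rw [h4]
      have h5 : μ ^ 2 = k * c - ν ^ 2 / 4 := by linarith
      have h6 : μ ^ 2 * (r ^ 2 / c ^ 2 * (k * c * E ^ 2 / μ ^ 2 - 1) + (2 * r - c) / c) =
          r ^ 2 / c ^ 2 * (k * c * E ^ 2 - μ ^ 2) + μ ^ 2 * ((2 * r - c) / c) := by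
        field_simp
      rw [h6, h5]
      field_simp
      ring
    rw [this, mul_nonneg_iff_of_pos_left (by positivity)]
  rw [hcond]
  constructor
  · rintro ⟨t, ht, h0, hJ⟩
    rw [hslope, mul_eq_zero, or_iff_right (Real.exp_pos _).ne', sub_eq_zero] at h0
    set η := d * Real.sin (μ * t) + g * Real.cos (μ * t) with hη
    have h1 : d = η * Real.sin (μ * t) := by
      linear_combination -d * Real.sin_sq_add_cos_sq (μ * t) + Real.cos (μ * t) * h0 -
        Real.sin (μ * t) * hη
    have h2 : g = η * Real.cos (μ * t) := by
      linear_combination -g * Real.sin_sq_add_cos_sq (μ * t) - Real.sin (μ * t) * h0 -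
        Real.cos (μ * t) * hη
    rw [hval t η h1 h2, hneg] at hJ
    have hηneg : η < 0 := by
      by_contra hcon
      have h3 := mul_nonneg hμ.le (not_lt.1 hcon)
      have h4 : 0 < k * r * Real.exp (ν / 2 * t) := by positivity
      linarith
    have hηsq : η ^ 2 = d ^ 2 + g ^ 2 := by
      conv_rhs => rw [h1, h2]
      linear_combination -η ^ 2 * Real.sin_sq_add_cos_sq (μ * t)
    have hηκ : η = κ := by
      have h3 : η ^ 2 = κ ^ 2 := by rw [hηsq, hκsq]
      rcases sq_eq_sq_iff_eq_or_eq_neg.1 h3 with h4 | h4 <;> linarith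
    rw [hηκ] at h1 h2 hJ hηneg
    have hcos : Real.cos (μ * t - θ) = 1 := by
      have hs : Real.sin (μ * t) = Real.sin θ := mul_left_cancel₀ hηneg.ne (h1.symm.trans hκd)
      have hC : Real.cos (μ * t) = Real.cos θ := mul_left_cancel₀ hηneg.ne (h2.symm.trans hκg)
      rw [Real.cos_sub, hs, hC]
      linear_combination Real.sin_sq_add_cos_sq θ
    obtain ⟨n, hn⟩ := (Real.cos_eq_one_iff _).1 hcos
    -- Here `θ ≤ 2π` is needed: `n ≤ -1` would give `μ t ≤ 0`.
    have hn0 : 0 ≤ n := by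
      by_contra hcon
      have h3 : (n : ℝ) ≤ -1 := by exact_mod_cast (by omega : n ≤ -1)
      have h4 := mul_pos hμ ht
      nlinarith [Real.pi_pos]
    have hle : θ / μ ≤ t := by
      rw [div_le_iff₀ hμ]
      have h3 : (0 : ℝ) ≤ n := by exact_mod_cast hn0
      nlinarith [Real.pi_pos]
    refine le_trans ?_ hJ
    gcongr
  · intro hle
    have hθ : μ * (θ / μ) = θ := by field_simp
    refine ⟨θ / μ, by positivity, ?_, ?_⟩
    · rw [hslope, hθ, hκg, hκd]
      ring
    · rw [hval (θ / μ) κ (by rw [hθ]; exact hκd) (by rw [hθ]; exact hκg), hneg]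
      exact hle

end Weak

/-- In every damping regime there is an impulse response, and the critical threshold is exactly the
vanishing of the stretch factor in finite time. -/
theorem exists_impulseResponse {c k ν : ℝ} (hc : 0 < c) (hk : 0 < k) (hν : 0 < ν) :
    ∃ B B' : ℝ → ℝ, IsImpulseResponse c k ν B B' ∧ ∀ r d : ℝ, 0 < r →
      ((∃ t, 0 ≤ t ∧ stretch c ν B B' r d t ≤ 0) ↔ Supercritical c k ν r d) := by
  have hkc : 0 < k * c := by positivity
  have hsq : √(k * c) ^ 2 = k * c := Real.sq_sqrt hkc.le
  have hsq0 : 0 < √(k * c) := Real.sqrt_pos.2 hkc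
  rcases lt_trichotomy ν (2 * √(k * c)) with h | h | h
  · have hpos : 0 < k * c - ν ^ 2 / 4 := by nlinarith
    have hμ : 0 < dampedFrequency c k ν := Real.sqrt_pos.2 hpos
    have hμsq : dampedFrequency c k ν ^ 2 = k * c - ν ^ 2 / 4 := Real.sq_sqrt hpos.le
    have hkc' : k * c = dampedFrequency c k ν ^ 2 + ν ^ 2 / 4 := by linarith
    have hB := isImpulseResponse_underdamped hν hμ hkc'
    refine ⟨_, _, hB, fun r d hr => ?_⟩
    rw [hB.exists_stretch_nonpos_iff hc hr,
      exists_stretch_nonpos_iff_underdamped hc hk hν hμ hkc' hr rfl rfl, Supercritical]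
    simp [h, h.ne, h.not_gt]
  · have hkc' : k * c = (ν / 2) ^ 2 := by rw [← hsq, h]; ring
    have hB := isImpulseResponse_critical (half_pos hν) (by ring) hkc'
    refine ⟨_, _, hB, fun r d hr => ?_⟩
    rw [hB.exists_stretch_nonpos_iff hc hr,
      exists_stretch_nonpos_iff_critical hc (half_pos hν) (by ring) hkc' hr rfl rfl, Supercritical]
    simp [h]
  · have hpos : 0 < ν ^ 2 - 4 * k * c := by nlinarith
    have hs : 0 < √(ν ^ 2 - 4 * k * c) := Real.sqrt_pos.2 hpos
    have hs2 : √(ν ^ 2 - 4 * k * c) ^ 2 = ν ^ 2 - 4 * k * c := Real.sq_sqrt hpos.le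
    have h1 : 0 < lam₁ c k ν := by
      have : √(ν ^ 2 - 4 * k * c) < ν := by
        rw [Real.sqrt_lt' hν]
        nlinarith
      exact div_pos (sub_pos.2 this) (by positivity)
    have h12 : lam₁ c k ν < lam₂ c k ν := by
      unfold lam₁ lam₂
      gcongr
      linarith
    have hsum : c * lam₁ c k ν + c * lam₂ c k ν = ν := by
      unfold lam₁ lam₂
      field_simp
      ring
    have hprod : c * lam₁ c k ν * lam₂ c k ν = k := by
      unfold lam₁ lam₂
      generalize √(ν ^ 2 - 4 * k * c) = s at *
      field_simp
      linear_combination -hs2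
    have hB := isImpulseResponse_overdamped (c := c) (k := k) (mul_pos hc h1)
      (mul_lt_mul_of_pos_left h12 hc) hsum (by linear_combination c * hprod)
    refine ⟨_, _, hB, fun r d hr => ?_⟩
    rw [hB.exists_stretch_nonpos_iff hc hr,
      exists_stretch_nonpos_iff_overdamped hc hk h1 h12 hsum hprod hr rfl rfl, Supercritical]
    simp [h, h.ne', h.not_gt, StrongCondition]

/-! ### The forced oscillator -/

theorem hasDerivAt_integral_of_continuous {f : ℝ → ℝ} (hf : Continuous f) (a t : ℝ) :
    HasDerivAt (fun t => ∫ s in a..t, f s) (f t) t :=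
  (hf.integral_hasStrictDerivAt a t).hasDerivAt

namespace IsImpulseResponse

variable {c k ν : ℝ} {B B' : ℝ → ℝ}

/-- The left side is the Wronskian `B'² - B B''` of the solutions `B'` and `B`, and this is Abel's
identity. It accounts for the weight `e^{νs}` in the variation of constants. -/
theorem energy_eq (h : IsImpulseResponse c k ν B B') (t : ℝ) :
    B' t ^ 2 + ν * B t * B' t + k * c * B t ^ 2 = Real.exp (-(ν * t)) := by
  have hd : ∀ t, HasDerivAt
      (fun t => Real.exp (ν * t) * (B' t ^ 2 + ν * B t * B' t + k * c * B t ^ 2)) 0 t := by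
    intro t
    have h1 : HasDerivAt (fun t => Real.exp (ν * t)) (ν * Real.exp (ν * t)) t := by
      simpa using hasDerivAt_exp_neg_mul (-ν) t
    have hB := h.hasDerivAt t
    have hB' := h.hasDerivAt_deriv t
    have := h1.mul (((hB'.pow 2).add ((hB.const_mul ν).mul hB')).add ((hB.pow 2).const_mul (k * c)))
    convert! this using 1
    simp only [Pi.add_apply, Pi.mul_apply, Pi.pow_apply]
    push_cast
    ring
  have h0 := is_const_of_deriv_eq_zero (fun t => (hd t).differentiableAt) (fun t => (hd t).deriv) t 0
  simp only [h.apply_zero, h.deriv_zero] at h0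
  rw [Real.exp_neg]
  refine eq_inv_of_mul_eq_one_right ?_
  rw [h0]
  simp

/-- Variation of constants for the forced damped oscillator. -/
theorem exists_forced (h : IsImpulseResponse c k ν B B') {H : ℝ → ℝ} (hH : Continuous H) :
    ∃ p p' : ℝ → ℝ, (∀ t, HasDerivAt p (p' t) t) ∧
      (∀ t, HasDerivAt p' (-ν * p' t - k * c * p t + k * H t) t) ∧ p 0 = 0 ∧ p' 0 = 0 := by
  have hBc : Continuous B := continuous_iff_continuousAt.2 fun t => (h.hasDerivAt t).continuousAt
  have hBc' : Continuous B' :=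
    continuous_iff_continuousAt.2 fun t => (h.hasDerivAt_deriv t).continuousAt
  set F₁ : ℝ → ℝ := fun t => ∫ s in (0 : ℝ)..t, B' s * (k * H s) * Real.exp (ν * s)
  set F₂ : ℝ → ℝ := fun t => ∫ s in (0 : ℝ)..t, B s * (k * H s) * Real.exp (ν * s)
  have hF₁ : ∀ t, HasDerivAt F₁ (B' t * (k * H t) * Real.exp (ν * t)) t := fun t =>
    hasDerivAt_integral_of_continuous (by fun_prop) 0 t
  have hF₂ : ∀ t, HasDerivAt F₂ (B t * (k * H t) * Real.exp (ν * t)) t := fun t =>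
    hasDerivAt_integral_of_continuous (by fun_prop) 0 t
  refine ⟨fun t => B t * F₁ t - B' t * F₂ t,
    fun t => B' t * F₁ t - (-ν * B' t - k * c * B t) * F₂ t, fun t => ?_, fun t => ?_, ?_, ?_⟩
  · convert! ((h.hasDerivAt t).mul (hF₁ t)).sub ((h.hasDerivAt_deriv t).mul (hF₂ t)) using 1
    ring
  · have h2 := (((h.hasDerivAt_deriv t).const_mul (-ν)).sub ((h.hasDerivAt t).const_mul (k * c)))
    convert! ((h.hasDerivAt_deriv t).mul (hF₁ t)).sub (h2.mul (hF₂ t)) using 1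
    have h3 : Real.exp (-(ν * t)) * Real.exp (ν * t) = 1 := by rw [← Real.exp_add]; simp
    simp only [Pi.sub_apply]
    linear_combination (-(k * H t)) * h3 - k * H t * Real.exp (ν * t) * h.energy_eq t
  · simp [F₁, F₂]
  · simp [F₁, F₂]

end IsImpulseResponse

/-! ### Solutions on closed strips -/

/-- A solution on the closed strip `[0, τ] × ℝ`, with electric field `E = -φ_x`. -/
structure IsStripSolution (c k ν τ : ℝ) (ρ u E : ℝ → ℝ → ℝ) : Prop where
  velocity : ContDiffOn ℝ 1 (fun p : ℝ × ℝ => u p.1 p.2) (Set.Icc 0 τ ×ˢ Set.univ)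
  density : ContinuousOn (fun p : ℝ × ℝ => ρ p.1 p.2) (Set.Icc 0 τ ×ˢ Set.univ)
  field : ∀ t ∈ Set.Ioo 0 τ, ∀ x, HasDerivAt (E t) (ρ t x - c) x
  momentum : ∀ t ∈ Set.Ioo 0 τ, ∀ x,
    deriv (fun s => u s x) t + u t x * deriv (fun y => u t y) x = k * E t x - ν * u t x
  mass : ∀ t ∈ Set.Ioo 0 τ, ∀ a b : ℝ, a ≤ b →
    HasDerivAt (fun s => ∫ x in a..b, ρ s x) (ρ t a * u t a - ρ t b * u t b) t

/-- Constant extension in time of a function on `[0, τ] × ℝ`. -/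
def timeExtend {α : Type*} (τ : ℝ) (f : ℝ → ℝ → α) (t x : ℝ) : α := f (max 0 (min τ t)) x

theorem timeExtend_of_mem {α : Type*} {τ t : ℝ} (f : ℝ → ℝ → α) (ht : t ∈ Set.Icc 0 τ) (x : ℝ) :
    timeExtend τ f t x = f t x := by
  rw [timeExtend, min_eq_right ht.2, max_eq_right ht.1]

theorem continuous_timeExtend {α : Type*} [TopologicalSpace α] {τ : ℝ} (hτ : 0 ≤ τ)
    {f : ℝ → ℝ → α}
    (hf : ContinuousOn (fun p : ℝ × ℝ => f p.1 p.2) (Set.Icc 0 τ ×ˢ Set.univ)) :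
    Continuous (fun p : ℝ × ℝ => timeExtend τ f p.1 p.2) :=
  hf.comp_continuous (f := fun p : ℝ × ℝ => (max 0 (min τ p.1), p.2)) (by fun_prop) fun p =>
    ⟨⟨le_max_left _ _, max_le hτ (min_le_left _ _)⟩, trivial⟩

/-- The derivative within the closed strip is continuous up to its boundary; freezing it in time
outside `[0, τ]` gives globally continuous functions, which compactness then bounds up to both ends.
-/
theorem exists_continuous_partials {τ : ℝ} (hτ : 0 < τ) {f : ℝ → ℝ → ℝ}
    (hf : ContDiffOn ℝ 1 (fun p : ℝ × ℝ => f p.1 p.2) (Set.Icc 0 τ ×ˢ Set.univ)) :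
    ∃ ft fx : ℝ → ℝ → ℝ, Continuous (fun p : ℝ × ℝ => ft p.1 p.2) ∧
      Continuous (fun p : ℝ × ℝ => fx p.1 p.2) ∧
      ∀ t ∈ Set.Ioo 0 τ, ∀ x, HasFDerivAt (fun p : ℝ × ℝ => f p.1 p.2)
        ((ContinuousLinearMap.fst ℝ ℝ ℝ).smulRight (ft t x) +
          (ContinuousLinearMap.snd ℝ ℝ ℝ).smulRight (fx t x)) (t, x) := by
  set S : Set (ℝ × ℝ) := Set.Icc 0 τ ×ˢ Set.univ
  set D : ℝ → ℝ → (ℝ × ℝ →L[ℝ] ℝ) := fun t x =>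
    fderivWithin ℝ (fun p : ℝ × ℝ => f p.1 p.2) S (t, x)
  have hS : UniqueDiffOn ℝ S := (uniqueDiffOn_Icc hτ).prod uniqueDiffOn_univ
  have hD : ContinuousOn (fun p : ℝ × ℝ => D p.1 p.2) S :=
    hf.continuousOn_fderivWithin hS le_rfl
  have hDc := continuous_timeExtend hτ.le hD
  refine ⟨fun t x => timeExtend τ D t x (1, 0), fun t x => timeExtend τ D t x (0, 1),
    hDc.clm_apply continuous_const, hDc.clm_apply continuous_const, fun t ht x => ?_⟩
  have hnhds : S ∈ 𝓝 (t, x) := prod_mem_nhds (Icc_mem_nhds ht.1 ht.2) univ_mem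
  have h1 : HasFDerivAt (fun p : ℝ × ℝ => f p.1 p.2) (D t x) (t, x) :=
    ((hf.differentiableOn one_ne_zero (t, x)
      (mem_of_mem_nhds hnhds)).hasFDerivWithinAt).hasFDerivAt hnhds
  simp only [timeExtend_of_mem D ⟨ht.1.le, ht.2.le⟩]
  convert h1 using 1
  ext <;> simp

section Partials

variable {f : ℝ → ℝ → ℝ} {ft fx t x : ℝ}

theorem hasDerivAt_comp_path (hf : HasFDerivAt (fun p : ℝ × ℝ => f p.1 p.2)
      ((ContinuousLinearMap.fst ℝ ℝ ℝ).smulRight ft +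
        (ContinuousLinearMap.snd ℝ ℝ ℝ).smulRight fx) (t, x))
    {X : ℝ → ℝ} {v : ℝ} (hX : HasDerivAt X v t) (hx : X t = x) :
    HasDerivAt (fun s => f s (X s)) (ft + v * fx) t := by
  subst hx
  have := hf.comp_hasDerivAt t ((hasDerivAt_id t).prodMk hX)
  convert! this using 1
  simp

theorem hasDerivAt_fst (hf : HasFDerivAt (fun p : ℝ × ℝ => f p.1 p.2)
      ((ContinuousLinearMap.fst ℝ ℝ ℝ).smulRight ft +
        (ContinuousLinearMap.snd ℝ ℝ ℝ).smulRight fx) (t, x)) :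
    HasDerivAt (fun s => f s x) ft t := by
  simpa using hasDerivAt_comp_path hf (hasDerivAt_const t x) rfl

theorem hasDerivAt_snd (hf : HasFDerivAt (fun p : ℝ × ℝ => f p.1 p.2)
      ((ContinuousLinearMap.fst ℝ ℝ ℝ).smulRight ft +
        (ContinuousLinearMap.snd ℝ ℝ ℝ).smulRight fx) (t, x)) :
    HasDerivAt (fun y => f t y) fx x := by
  have := hf.comp_hasDerivAt x ((hasDerivAt_const x t).prodMk (hasDerivAt_id x))
  convert! this using 1
  simp

theorem hasFDerivAt_of_partials (hf : DifferentiableAt ℝ (fun p : ℝ × ℝ => f p.1 p.2) (t, x))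
    (h₁ : HasDerivAt (fun s => f s x) ft t) (h₂ : HasDerivAt (fun y => f t y) fx x) :
    HasFDerivAt (fun p : ℝ × ℝ => f p.1 p.2)
      ((ContinuousLinearMap.fst ℝ ℝ ℝ).smulRight ft +
        (ContinuousLinearMap.snd ℝ ℝ ℝ).smulRight fx) (t, x) := by
  have hd := hf.hasFDerivAt
  have d₁ := hd.comp_hasDerivAt t ((hasDerivAt_id t).prodMk (hasDerivAt_const t x))
  have d₂ := hd.comp_hasDerivAt x ((hasDerivAt_const x t).prodMk (hasDerivAt_id x))
  have e₁ := h₁.unique d₁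
  have e₂ := h₂.unique d₂
  have : (ContinuousLinearMap.fst ℝ ℝ ℝ).smulRight ft +
      (ContinuousLinearMap.snd ℝ ℝ ℝ).smulRight fx =
        fderiv ℝ (fun p : ℝ × ℝ => f p.1 p.2) (t, x) := by
    ext
    · simpa using e₁
    · simpa using e₂
  rwa [this]

end Partials

/-! ### Characteristics of an arbitrary solution -/

namespace IsStripSolution

variable {c k ν τ : ℝ} {ρ u E : ℝ → ℝ → ℝ}

/-- The mass coordinate: `∂ₓm = ρ` and `∂ₜm = -ρu`. -/
def massCoord (τ : ℝ) (ρ u : ℝ → ℝ → ℝ) (t x : ℝ) : ℝ :=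
  (∫ y in (0 : ℝ)..x, timeExtend τ ρ t y) -
    ∫ s in (0 : ℝ)..t, timeExtend τ ρ s 0 * timeExtend τ u s 0

theorem continuous_density (h : IsStripSolution c k ν τ ρ u E) (hτ : 0 < τ) :
    Continuous (fun p : ℝ × ℝ => timeExtend τ ρ p.1 p.2) :=
  continuous_timeExtend hτ.le h.density

theorem continuous_velocity (h : IsStripSolution c k ν τ ρ u E) (hτ : 0 < τ) :
    Continuous (fun p : ℝ × ℝ => timeExtend τ u p.1 p.2) :=
  continuous_timeExtend hτ.le h.velocity.continuousOn

theorem continuous_flux (h : IsStripSolution c k ν τ ρ u E) (hτ : 0 < τ) (x : ℝ) :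
    Continuous (fun s => timeExtend τ ρ s x * timeExtend τ u s x) :=
  ((h.continuous_density hτ).comp (by fun_prop : Continuous fun s : ℝ => (s, x))).mul
    ((h.continuous_velocity hτ).comp (by fun_prop : Continuous fun s : ℝ => (s, x)))

theorem continuous_massCoord (h : IsStripSolution c k ν τ ρ u E) (hτ : 0 < τ) :
    Continuous (fun p : ℝ × ℝ => massCoord τ ρ u p.1 p.2) := by
  have h1 : Continuous fun p : ℝ × ℝ => ∫ y in (0 : ℝ)..p.2, timeExtend τ ρ p.1 y :=
    intervalIntegral.continuous_parametric_intervalIntegral_of_continuous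
      (f := fun (p : ℝ × ℝ) y => timeExtend τ ρ p.1 y)
      ((h.continuous_density hτ).comp
        (by fun_prop : Continuous fun q : (ℝ × ℝ) × ℝ => (q.1.1, q.2))) continuous_snd
  have h2 : Continuous fun t : ℝ =>
      ∫ s in (0 : ℝ)..t, timeExtend τ ρ s 0 * timeExtend τ u s 0 :=
    intervalIntegral.continuous_primitive
      (fun a b => (h.continuous_flux hτ 0).intervalIntegrable a b) 0
  exact h1.sub (h2.comp continuous_fst)

theorem hasDerivAt_massCoord_snd (h : IsStripSolution c k ν τ ρ u E) (hτ : 0 < τ) (t x : ℝ) :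
    HasDerivAt (massCoord τ ρ u t) (timeExtend τ ρ t x) x :=
  (hasDerivAt_integral_of_continuous ((h.continuous_density hτ).comp
    (by fun_prop : Continuous fun y : ℝ => (t, y))) 0 x).sub_const _

theorem hasDerivAt_massCoord_fst (h : IsStripSolution c k ν τ ρ u E) (hτ : 0 < τ) {t : ℝ}
    (ht : t ∈ Set.Ioo 0 τ) (x : ℝ) :
    HasDerivAt (fun s => massCoord τ ρ u s x) (-(timeExtend τ ρ t x * timeExtend τ u t x)) t := by
  have ht' : t ∈ Set.Icc 0 τ := ⟨ht.1.le, ht.2.le⟩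
  have h1 : HasDerivAt (fun s => ∫ y in (0 : ℝ)..x, ρ s y)
      (ρ t 0 * u t 0 - ρ t x * u t x) t := by
    rcases le_total 0 x with hx | hx
    · exact h.mass t ht 0 x hx
    · have := (h.mass t ht x 0 hx).neg
      rw [neg_sub] at this
      refine this.congr_of_eventuallyEq (Eventually.of_forall fun s => ?_)
      exact intervalIntegral.integral_symm _ _
  have h1' : HasDerivAt (fun s => ∫ y in (0 : ℝ)..x, timeExtend τ ρ s y)
      (ρ t 0 * u t 0 - ρ t x * u t x) t := by
    refine h1.congr_of_eventuallyEq ?_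
    filter_upwards [Icc_mem_nhds ht.1 ht.2] with s hs
    simp only [timeExtend_of_mem ρ hs]
  have h2 := hasDerivAt_integral_of_continuous (h.continuous_flux hτ 0) 0 t
  convert! h1'.sub h2 using 1
  simp only [timeExtend_of_mem _ ht']
  ring

/-- The mass coordinate has continuous partials even if `ρ` is only continuous, so the chain rule
applies along any differentiable path. Its rate of change is proportional to the amount by which the
path fails to be a characteristic. -/
theorem hasDerivAt_massCoord_comp (h : IsStripSolution c k ν τ ρ u E) (hτ : 0 < τ) {t v : ℝ}
    (ht : t ∈ Set.Ioo 0 τ) {X : ℝ → ℝ} (hX : HasDerivAt X v t) :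
    HasDerivAt (fun s => massCoord τ ρ u s (X s))
      (timeExtend τ ρ t (X t) * (v - timeExtend τ u t (X t))) t := by
  have hρ := h.continuous_density hτ
  have hu := h.continuous_velocity hτ
  set f₁ : ℝ → ℝ → ℝ →L[ℝ] ℝ := fun t x =>
    ContinuousLinearMap.toSpanSingleton ℝ (-(timeExtend τ ρ t x * timeExtend τ u t x))
  set f₂ : ℝ → ℝ → ℝ →L[ℝ] ℝ := fun t x =>
    ContinuousLinearMap.toSpanSingleton ℝ (timeExtend τ ρ t x)
  have hspan : Continuous fun y : ℝ => ContinuousLinearMap.toSpanSingleton ℝ y :=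
    (ContinuousLinearMap.toSpanSingletonCLE (𝕜 := ℝ) (E := ℝ)).continuous
  have hf := hasStrictFDerivAt_uncurry_coprod (𝕜 := ℝ) (u := (t, X t)) (f := massCoord τ ρ u)
    (f₁ := f₁) (f₂ := f₂)
    (by
      filter_upwards [prod_mem_nhds (Ioo_mem_nhds ht.1 ht.2) univ_mem] with v hv
      exact (h.hasDerivAt_massCoord_fst hτ hv.1 v.2).hasFDerivAt)
    (Eventually.of_forall fun v => (h.hasDerivAt_massCoord_snd hτ v.1 v.2).hasFDerivAt)
    (hspan.comp (hρ.mul hu).neg).continuousAt (hspan.comp hρ).continuousAt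
  have := hf.hasFDerivAt.comp_hasDerivAt t ((hasDerivAt_id t).prodMk hX)
  convert! this using 1
  simp [f₁, f₂, Function.HasUncurry.uncurry]
  ring

/-- `E - (m - c x)` has zero `x`-derivative. Continuity in time of what remains is not part of the
Poisson equation; it comes from solving the momentum equation at `x = 0` for `E`. -/
theorem exists_field_eq (h : IsStripSolution c k ν τ ρ u E) (hτ : 0 < τ) (hk : k ≠ 0) :
    ∃ H : ℝ → ℝ, Continuous H ∧ ∀ t ∈ Set.Ioo 0 τ, ∀ x,
      E t x = massCoord τ ρ u t x - c * x + H t := by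
  obtain ⟨ut, ux, hut, hux, hD⟩ := exists_continuous_partials hτ h.velocity
  have hu := h.continuous_velocity hτ
  have hline : Continuous fun s : ℝ => (s, (0 : ℝ)) := by fun_prop
  refine ⟨fun t => (ut t 0 + timeExtend τ u t 0 * ux t 0 + ν * timeExtend τ u t 0) / k +
    ∫ s in (0 : ℝ)..t, timeExtend τ ρ s 0 * timeExtend τ u s 0, ?_, fun t ht x => ?_⟩
  · refine Continuous.add (Continuous.div_const ?_ _) (intervalIntegral.continuous_primitive
      (fun a b => (h.continuous_flux hτ 0).intervalIntegrable a b) 0)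
    exact ((hut.comp hline).add ((hu.comp hline).mul (hux.comp hline))).add
      (continuous_const.mul (hu.comp hline))
  · have ht' : t ∈ Set.Icc 0 τ := ⟨ht.1.le, ht.2.le⟩
    have h1 := hasDerivAt_fst (hD t ht 0)
    have h2 := hasDerivAt_snd (hD t ht 0)
    have hm := h.momentum t ht 0
    rw [h1.deriv, h2.deriv] at hm
    have hconst : ∀ y, HasDerivAt (fun x => E t x - (massCoord τ ρ u t x - c * x)) 0 y := by
      intro y
      have := (h.field t ht y).sub ((h.hasDerivAt_massCoord_snd hτ t y).sub
        ((hasDerivAt_id y).const_mul c))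
      convert! this using 1
      rw [timeExtend_of_mem ρ ht']
      ring
    have h3 := is_const_of_deriv_eq_zero (fun y => (hconst y).differentiableAt)
      (fun y => (hconst y).deriv) x 0
    have h4 : (ut t 0 + timeExtend τ u t 0 * ux t 0 + ν * timeExtend τ u t 0) / k = E t 0 := by
      rw [timeExtend_of_mem u ht', hm]
      field_simp
      ring
    have h5 : massCoord τ ρ u t 0 =
        -∫ s in (0 : ℝ)..t, timeExtend τ ρ s 0 * timeExtend τ u s 0 := by simp [massCoord]
    simp only [h4]
    rw [h5] at h3
    linarith

/-- A path solving the Lagrangian oscillator equation is a characteristic. -/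
theorem isCharacteristic (h : IsStripSolution c k ν τ ρ u E) (hτ : 0 < τ) {H : ℝ → ℝ}
    (hE : ∀ t ∈ Set.Ioo 0 τ, ∀ x, E t x = massCoord τ ρ u t x - c * x + H t)
    {X V : ℝ → ℝ} {α : ℝ} (hX : ∀ t, HasDerivAt X (V t) t)
    (hV : ∀ t, HasDerivAt V (-ν * V t - k * c * X t + k * (massCoord τ ρ u 0 α + H t)) t)
    (hX0 : X 0 = α) (hV0 : V 0 = u 0 α) :
    ∀ t ∈ Set.Icc 0 τ, V t = u t (X t) := by
  obtain ⟨ut, ux, hut, hux, hD⟩ := exists_continuous_partials hτ h.velocity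
  have hXc : Continuous X := continuous_iff_continuousAt.2 fun t => (hX t).continuousAt
  have hVc : Continuous V := continuous_iff_continuousAt.2 fun t => (hV t).continuousAt
  have hpath : Continuous fun t => (t, X t) := continuous_id.prodMk hXc
  have huc := (h.continuous_velocity hτ).comp hpath
  have hρc := (h.continuous_density hτ).comp hpath
  have hmc := (h.continuous_massCoord hτ).comp hpath
  have huxc := hux.comp hpath
  obtain ⟨K, hK⟩ := (isCompact_Icc (a := (0 : ℝ)) (b := τ)).exists_bound_of_continuousOn
    (f := fun t => |ν| + |ux t (X t)| + |k| + |timeExtend τ ρ t (X t)|)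
    (((continuous_const.add huxc.abs).add continuous_const).add hρc.abs).continuousOn
  -- The velocity defect `w` and the mass defect `e` both vanish at `0` and solve a homogeneous
  -- linear system with coefficients controlled by `K`. Hence `e^{-2Kt} (w² + e²)` is nonincreasing
  -- and both stay zero.
  set w : ℝ → ℝ := fun t => V t - timeExtend τ u t (X t)
  set e : ℝ → ℝ := fun t => massCoord τ ρ u t (X t) - massCoord τ ρ u 0 α
  have hw : ∀ t ∈ Set.Ioo 0 τ,
      HasDerivAt w (-ν * w t - ux t (X t) * w t - k * e t) t := by
    intro t ht
    have ht' : t ∈ Set.Icc 0 τ := ⟨ht.1.le, ht.2.le⟩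
    have h1 : HasDerivAt (fun s => timeExtend τ u s (X s)) (ut t (X t) + V t * ux t (X t)) t := by
      refine (hasDerivAt_comp_path (hD t ht (X t)) (hX t) rfl).congr_of_eventuallyEq ?_
      filter_upwards [Icc_mem_nhds ht.1 ht.2] with s hs
      exact timeExtend_of_mem u hs _
    have h2 := hasDerivAt_fst (hD t ht (X t))
    have h3 := hasDerivAt_snd (hD t ht (X t))
    have hm := h.momentum t ht (X t)
    rw [h2.deriv, h3.deriv, hE t ht] at hm
    convert! (hV t).sub h1 using 1
    simp only [w, e, timeExtend_of_mem u ht']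
    linear_combination hm
  have he : ∀ t ∈ Set.Ioo 0 τ, HasDerivAt e (timeExtend τ ρ t (X t) * w t) t := fun t ht =>
    (h.hasDerivAt_massCoord_comp hτ ht (hX t)).sub_const _
  have hanti : AntitoneOn (fun t => Real.exp (-(2 * K * t)) * (w t ^ 2 + e t ^ 2))
      (Set.Icc 0 τ) := by
    have hwc : Continuous w := hVc.sub huc
    have hec : Continuous e := hmc.sub continuous_const
    have hder : ∀ t ∈ Set.Ioo 0 τ, HasDerivAt
        (fun t => Real.exp (-(2 * K * t)) * (w t ^ 2 + e t ^ 2))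
        (Real.exp (-(2 * K * t)) * (-2 * K * (w t ^ 2 + e t ^ 2) +
          2 * w t * (-ν * w t - ux t (X t) * w t - k * e t) +
          2 * e t * (timeExtend τ ρ t (X t) * w t))) t := by
      intro t ht
      convert! (hasDerivAt_exp_neg_mul (2 * K) t).mul (((hw t ht).pow 2).add ((he t ht).pow 2))
        using 1
      simp only [Pi.add_apply, Pi.pow_apply]
      push_cast
      ring
    refine antitoneOn_of_deriv_nonpos (convex_Icc 0 τ) (by fun_prop) ?_ ?_
    · rw [interior_Icc]
      exact fun t ht => (hder t ht).differentiableAt.differentiableWithinAt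
    · rw [interior_Icc]
      intro t ht
      rw [(hder t ht).deriv]
      refine mul_nonpos_of_nonneg_of_nonpos (Real.exp_pos _).le ?_
      have hb := (le_abs_self _).trans (hK t ⟨ht.1.le, ht.2.le⟩)
      generalize w t = w at *
      generalize e t = e at *
      generalize ux t (X t) = a at *
      generalize timeExtend τ ρ t (X t) = r at *
      have hwe : 2 * |w * e| ≤ w ^ 2 + e ^ 2 := by
        rw [abs_mul]
        nlinarith [sq_nonneg (|w| - |e|), sq_abs w, sq_abs e]
      have i1 : -ν * w ^ 2 ≤ |ν| * (w ^ 2 + e ^ 2) := by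
        nlinarith [neg_abs_le ν, sq_nonneg w, sq_nonneg e, abs_nonneg ν]
      have i2 : -a * w ^ 2 ≤ |a| * (w ^ 2 + e ^ 2) := by
        nlinarith [neg_abs_le a, sq_nonneg w, sq_nonneg e, abs_nonneg a]
      have i3 : -k * (2 * (w * e)) ≤ |k| * (w ^ 2 + e ^ 2) := by
        refine (le_abs_self _).trans ?_
        rw [abs_mul, abs_neg, abs_mul, abs_two]
        gcongr
      have i4 : r * (2 * (w * e)) ≤ |r| * (w ^ 2 + e ^ 2) := by
        refine (le_abs_self _).trans ?_
        rw [abs_mul, abs_mul, abs_two]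
        gcongr
      have i5 := mul_le_mul_of_nonneg_right hb (add_nonneg (sq_nonneg w) (sq_nonneg e))
      have i6 : 0 ≤ |k| * (w ^ 2 + e ^ 2) := by positivity
      have i7 : 0 ≤ |r| * (w ^ 2 + e ^ 2) := by positivity
      nlinarith
  intro t ht
  have h0 : (0 : ℝ) ∈ Set.Icc 0 τ := ⟨le_rfl, hτ.le⟩
  have h1 := hanti h0 ht ht.1
  have hw0 : w 0 = 0 := by simp [w, timeExtend_of_mem u h0, hX0, hV0]
  have he0 : e 0 = 0 := by simp [e, hX0]
  simp only [hw0, he0] at h1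
  have h2 : w t ^ 2 + e t ^ 2 ≤ 0 := by
    by_contra hcon
    have := mul_pos (Real.exp_pos (-(2 * K * t))) (not_le.1 hcon)
    simp only [ne_eq, OfNat.ofNat_ne_zero, not_false_eq_true, zero_pow, add_zero, mul_zero] at h1
    linarith
  have h3 : w t = 0 := by
    have : w t ^ 2 = 0 := le_antisymm (by nlinarith [sq_nonneg (e t)]) (sq_nonneg _)
    exact pow_eq_zero_iff two_ne_zero |>.1 this
  simp only [w, timeExtend_of_mem u ht] at h3
  linarith

theorem exists_lipschitz (h : IsStripSolution c k ν τ ρ u E) (hτ : 0 < τ) (R : ℝ) :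
    ∃ K : ℝ, ∀ t ∈ Set.Ioo 0 τ, ∀ x ∈ Set.Icc (-R) R, ∀ y ∈ Set.Icc (-R) R,
      |u t y - u t x| ≤ K * |y - x| := by
  obtain ⟨ut, ux, hut, hux, hD⟩ := exists_continuous_partials hτ h.velocity
  obtain ⟨K, hK⟩ := ((isCompact_Icc (a := (0 : ℝ)) (b := τ)).prod
    (isCompact_Icc (a := -R) (b := R))).exists_bound_of_continuousOn hux.continuousOn
  refine ⟨K, fun t ht x hx y hy => ?_⟩
  refine Convex.norm_image_sub_le_of_norm_hasDerivWithin_le (f := u t) (f' := ux t)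
    (fun z hz => ?_) (fun z hz => hK (t, z) ⟨⟨ht.1.le, ht.2.le⟩, hz⟩) (convex_Icc _ _) hx hy
  exact (hasDerivAt_snd (hD t ht z)).hasDerivWithinAt

/-- Distinct characteristics stay apart by a definite factor, hence the stretch factor cannot
vanish while the solution exists. -/
theorem stretch_ne_zero (h : IsStripSolution c k ν τ ρ u E) (hτ : 0 < τ) (hc : c ≠ 0) (hk : k ≠ 0)
    {B B' : ℝ → ℝ} (hB : IsImpulseResponse c k ν B B') (hu₀ : Differentiable ℝ (u 0)) (α : ℝ) :
    stretch c ν B B' (ρ 0 α) (deriv (u 0) α) τ ≠ 0 := by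
  obtain ⟨H, hH, hE⟩ := h.exists_field_eq hτ hk
  obtain ⟨p, p', hp, hp', hp0, hp0'⟩ := hB.exists_forced hH
  set g : ℝ → ℝ := fun t => (1 - B' t - ν * B t) / c with hg
  have hgd : ∀ t, HasDerivAt g (k * B t) t := hB.hasDerivAt_gain hc
  have hBc : Continuous B := continuous_iff_continuousAt.2 fun t => (hB.hasDerivAt t).continuousAt
  have hgc : Continuous g := continuous_iff_continuousAt.2 fun t => (hgd t).continuousAt
  have hpc : Continuous p := continuous_iff_continuousAt.2 fun t => (hp t).continuousAt
  set m₀ : ℝ → ℝ := massCoord τ ρ u 0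
  have hm₀d : ∀ β, HasDerivAt m₀ (ρ 0 β) β := fun β => by
    have := h.hasDerivAt_massCoord_snd hτ 0 β
    rwa [timeExtend_of_mem ρ ⟨le_rfl, hτ.le⟩] at this
  have hm₀c : Continuous m₀ := continuous_iff_continuousAt.2 fun t => (hm₀d t).continuousAt
  have hu₀c := hu₀.continuous
  -- The explicit oscillator path starting at `β`; `p` carries the force `H`, common to all paths
  -- and so invisible to `∂/∂β`.
  set X : ℝ → ℝ → ℝ := fun β t => β + B t * u 0 β + g t * (m₀ β - c * β) + p t
  set V : ℝ → ℝ → ℝ := fun β t => B' t * u 0 β + k * B t * (m₀ β - c * β) + p' t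
  have hXd : ∀ β t, HasDerivAt (X β) (V β t) t := fun β t =>
    ((((hB.hasDerivAt t).mul_const (u 0 β)).const_add β).add ((hgd t).mul_const _)).add (hp t)
  have hVd : ∀ β t, HasDerivAt (V β) (-ν * V β t - k * c * X β t + k * (m₀ β + H t)) t := by
    intro β t
    convert! (((hB.hasDerivAt_deriv t).mul_const (u 0 β)).add
      (((hB.hasDerivAt t).const_mul k).mul_const (m₀ β - c * β))).add (hp' t) using 1
    simp only [X, V, hg]
    field_simp
    ring
  have hg0 : g 0 = 0 := by simp [hg, hB.apply_zero, hB.deriv_zero]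
  have hX0 : ∀ β, X β 0 = β := fun β => by simp [X, hB.apply_zero, hg0, hp0]
  have hV0 : ∀ β, V β 0 = u 0 β := fun β => by simp [V, hB.apply_zero, hB.deriv_zero, hp0']
  have hchar : ∀ β, ∀ t ∈ Set.Icc 0 τ, V β t = u t (X β t) := fun β =>
    h.isCharacteristic hτ hE (hXd β) (hVd β) (hX0 β) (hV0 β)
  obtain ⟨R, hR⟩ := ((isCompact_Icc (a := (0 : ℝ)) (b := τ)).prod
    (isCompact_Icc (a := α - 1) (b := α + 1))).exists_bound_of_continuousOn
    (f := fun q : ℝ × ℝ => X q.2 q.1) (by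
      refine Continuous.continuousOn ?_
      change Continuous fun q : ℝ × ℝ =>
        q.2 + B q.1 * u 0 q.2 + g q.1 * (m₀ q.2 - c * q.2) + p q.1
      fun_prop)
  obtain ⟨K, hK⟩ := h.exists_lipschitz hτ R
  -- Backward Gronwall: since `|u t y - u t x| ≤ K |y - x|` on a box containing these paths,
  -- `e^{2Kt}` times their squared distance is nondecreasing.
  have hsep : ∀ β ∈ Set.Icc (α - 1) (α + 1),
      (β - α) ^ 2 ≤ Real.exp (2 * K * τ) * (X β τ - X α τ) ^ 2 := by
    intro β hβ
    have hαm : α ∈ Set.Icc (α - 1) (α + 1) := ⟨by linarith, by linarith⟩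
    have hder : ∀ t, HasDerivAt (fun t => Real.exp (-(-(2 * K) * t)) * (X β t - X α t) ^ 2)
        (Real.exp (-(-(2 * K) * t)) * (2 * (X β t - X α t) * (V β t - V α t) +
          2 * K * (X β t - X α t) ^ 2)) t := by
      intro t
      convert! (hasDerivAt_exp_neg_mul (-(2 * K)) t).mul (((hXd β t).sub (hXd α t)).pow 2) using 1
      simp only [Pi.sub_apply, Pi.pow_apply]
      push_cast
      ring
    have hmono : MonotoneOn (fun t => Real.exp (-(-(2 * K) * t)) * (X β t - X α t) ^ 2)
        (Set.Icc 0 τ) := by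
      refine monotoneOn_of_deriv_nonneg (convex_Icc 0 τ)
        (fun t _ => (hder t).continuousAt.continuousWithinAt)
        (fun t _ => (hder t).differentiableAt.differentiableWithinAt) ?_
      rw [interior_Icc]
      intro t ht
      have ht' : t ∈ Set.Icc 0 τ := ⟨ht.1.le, ht.2.le⟩
      rw [(hder t).deriv, hchar β t ht', hchar α t ht']
      refine mul_nonneg (Real.exp_pos _).le ?_
      have h1 := hK t ht (X α t) (abs_le.1 (hR (t, α) ⟨ht', hαm⟩)) (X β t)
        (abs_le.1 (hR (t, β) ⟨ht', hβ⟩))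
      generalize u t (X β t) - u t (X α t) = y at *
      generalize X β t - X α t = z at *
      have h2 : -(z * y) ≤ K * z ^ 2 := by
        calc -(z * y) ≤ |z * y| := neg_le_abs _
          _ = |z| * |y| := abs_mul _ _
          _ ≤ |z| * (K * |z|) := by gcongr
          _ = K * z ^ 2 := by rw [← sq_abs z]; ring
      linarith
    have := hmono ⟨le_rfl, hτ.le⟩ ⟨hτ.le, le_rfl⟩ hτ.le
    simp only [hX0] at this
    simpa using this
  have hXα : HasDerivAt (fun β => X β τ) (stretch c ν B B' (ρ 0 α) (deriv (u 0) α) τ) α := by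
    convert! (((hasDerivAt_id α).add ((hu₀ α).hasDerivAt.const_mul (B τ))).add
      (((hm₀d α).sub ((hasDerivAt_id α).const_mul c)).const_mul (g τ))).add_const (p τ) using 1
    simp [stretch, hg]
  intro h0
  rw [h0, hasDerivAt_iff_isLittleO] at hXα
  -- Half the guaranteed separation rate: a zero derivative in `β` would give `(β - α)² ≤ (β -
  -- α)²/4` for nearby `β > α`.
  have hε : 0 < Real.exp (-(K * τ)) / 2 := by positivity
  have hev := hXα.def hε
  have hnear : ∀ᶠ β in 𝓝[>] α, β ∈ Set.Ioc α (α + 1) := Ioc_mem_nhdsGT (by linarith)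
  obtain ⟨β, h1, h2⟩ := ((hev.filter_mono nhdsWithin_le_nhds).and hnear).exists
  have h3 := hsep β ⟨by linarith [h2.1], h2.2⟩
  simp only [smul_zero, sub_zero, Real.norm_eq_abs] at h1
  have h4 : (X β τ - X α τ) ^ 2 ≤ (Real.exp (-(K * τ)) / 2 * |β - α|) ^ 2 := by
    rw [← sq_abs (X β τ - X α τ)]
    gcongr
  have h5 : Real.exp (2 * K * τ) * (Real.exp (-(K * τ)) / 2 * |β - α|) ^ 2 = (β - α) ^ 2 / 4 := by
    have : Real.exp (2 * K * τ) * Real.exp (-(K * τ)) ^ 2 = 1 := by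
      rw [← Real.exp_nat_mul, ← Real.exp_add]
      norm_num
      ring
    rw [mul_pow, sq_abs]
    linear_combination (β - α) ^ 2 / 4 * this
  have h6 := mul_le_mul_of_nonneg_left h4 (Real.exp_pos (2 * K * τ)).le
  have h7 : 0 < (β - α) ^ 2 := by
    have := sub_pos.2 h2.1
    positivity
  linarith

end IsStripSolution

/-! ### Bounding the lifespan; classical solutions as continuous ones -/

section Breakdown

variable {c k ν : ℝ} {ρ₀ u₀ : ℝ → ℝ} {T : ℝ≥0∞} {ρ u : ℝ → ℝ → ℝ}

theorem strip_subset_slab {τ : ℝ} (hτ : ENNReal.ofReal τ < T) :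
    Set.Icc 0 τ ×ˢ Set.univ ⊆ slab T := fun _ hp =>
  ⟨hp.1.1, (ENNReal.ofReal_le_ofReal hp.1.2).trans_lt hτ⟩

theorem IsContinuousSolution.exists_isStripSolution
    (h : IsContinuousSolution c k ν ρ₀ u₀ T ρ u) {τ : ℝ} (hτ : ENNReal.ofReal τ < T) :
    ∃ E, IsStripSolution c k ν τ ρ u E := by
  obtain ⟨φ, hφ⟩ := h.exists_potential
  have hlt : ∀ t ∈ Set.Ioo 0 τ, ENNReal.ofReal t < T := fun t ht =>
    (ENNReal.ofReal_le_ofReal ht.2.le).trans_lt hτ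
  refine ⟨fun t x => -deriv (φ t) x, h.velocity_contDiffOn.mono (strip_subset_slab hτ),
    h.density_continuousOn.mono (strip_subset_slab hτ), fun t ht x => ?_, fun t ht x => ?_,
    fun t ht => h.mass_balance t ht.1 (hlt t ht)⟩
  · obtain ⟨hC, -, -, heq⟩ := hφ t ht.1 (hlt t ht)
    have hC1 : ContDiff ℝ 1 (deriv (φ t)) := by
      have : ContDiff ℝ (1 + 1) (φ t) := by
        rw [one_add_one_eq_two]
        exact hC
      exact (contDiff_succ_iff_deriv.1 this).2.2
    have := ((hC1.differentiable one_ne_zero) x).hasDerivAt.neg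
    rw [(heq x).1] at this
    exact this
  · obtain ⟨-, -, -, heq⟩ := hφ t ht.1 (hlt t ht)
    rw [(heq x).2]
    ring

/-- Starting from `1`, the stretch factor vanishes at some `τ ≤ t`; a lifespan beyond `t` would
contain the closed strip up to `τ`, where `stretch_ne_zero` applies. -/
theorem IsContinuousSolution.le_of_stretch_nonpos (h : IsContinuousSolution c k ν ρ₀ u₀ T ρ u)
    (hc : c ≠ 0) (hk : k ≠ 0) {B B' : ℝ → ℝ} (hB : IsImpulseResponse c k ν B B')
    (hu₀ : Differentiable ℝ u₀) {x t : ℝ} (ht : 0 ≤ t)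
    (hs : stretch c ν B B' (ρ₀ x) (deriv u₀ x) t ≤ 0) : T ≤ ENNReal.ofReal t := by
  by_contra hcon
  rw [not_le] at hcon
  have hcont : Continuous (stretch c ν B B' (ρ₀ x) (deriv u₀ x)) :=
    continuous_iff_continuousAt.2 fun t => (hB.hasDerivAt_stretch hc _ _ t).continuousAt
  obtain ⟨τ, hτ, hτ0⟩ := intermediate_value_Icc' ht hcont.continuousOn
    ⟨hs, (hB.stretch_zero (ρ₀ x) (deriv u₀ x)).symm ▸ zero_le_one⟩
  have hτpos : 0 < τ := by
    rcases hτ.1.eq_or_lt with h0 | h0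
    · rw [← h0, hB.stretch_zero] at hτ0
      exact absurd hτ0 one_ne_zero
    · exact h0
  obtain ⟨E, hE⟩ := h.exists_isStripSolution
    ((ENNReal.ofReal_le_ofReal hτ.2).trans_lt hcon)
  have hu : u 0 = u₀ := funext h.initial_velocity
  have := hE.stretch_ne_zero hτpos hc hk hB (hu ▸ hu₀) x
  rw [hu, h.initial_density] at this
  exact this hτ0

theorem IsClassicalSolution.isContinuousSolution (h : IsClassicalSolution c k ν ρ₀ u₀ T ρ u) :
    IsContinuousSolution c k ν ρ₀ u₀ T ρ u where
  toIsMomentumSolution := h.toIsMomentumSolution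
  density_continuousOn := h.density_contDiffOn.continuousOn
  mass_balance := by
    intro t ht htT a b _
    obtain ⟨τ, htτ, hτT⟩ : ∃ τ : ℝ, t < τ ∧ ENNReal.ofReal τ < T := by
      obtain ⟨q, hq, hqT⟩ := ENNReal.lt_iff_exists_nnreal_btwn.1 htT
      refine ⟨q, ?_, by simpa using hqT⟩
      rw [← ENNReal.ofReal_coe_nnreal] at hq
      exact (ENNReal.ofReal_lt_ofReal_iff_of_nonneg ht.le).1 hq
    have hτ : 0 < τ := ht.trans htτ
    obtain ⟨rt, rx, hrt, hrx, hDr⟩ := exists_continuous_partials hτ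
      (h.density_contDiffOn.mono (strip_subset_slab hτT))
    obtain ⟨ut, ux, hut, hux, hDu⟩ := exists_continuous_partials hτ
      (h.velocity_contDiffOn.mono (strip_subset_slab hτT))
    have hslice : ∀ s ∈ Set.Ioo 0 τ, Continuous (ρ s) := fun s hs =>
      continuous_iff_continuousAt.2 fun x => (hasDerivAt_snd (hDr s hs x)).continuousAt
    have hmem : t ∈ Set.Ioo 0 τ := ⟨ht, htτ⟩
    obtain ⟨K, hK⟩ := ((isCompact_Icc (a := (0 : ℝ)) (b := τ)).prod
      (isCompact_uIcc (a := a) (b := b))).exists_bound_of_continuousOn hrt.continuousOn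
    have hrtt : Continuous (rt t) := hrt.comp (by fun_prop : Continuous fun x : ℝ => (t, x))
    have hdiff := (intervalIntegral.hasDerivAt_integral_of_dominated_loc_of_deriv_le
      (μ := MeasureTheory.volume) (F := ρ) (F' := rt) (x₀ := t) (a := a) (b := b)
      (bound := fun _ => K) (Ioo_mem_nhds ht htτ)
      (by
        filter_upwards [Ioo_mem_nhds ht htτ] with s hs
        exact (hslice s hs).aestronglyMeasurable)
      ((hslice t hmem).intervalIntegrable a b) hrtt.aestronglyMeasurable
      (Eventually.of_forall fun x hx s hs =>
        hK (s, x) ⟨⟨hs.1.le, hs.2.le⟩, Set.uIoc_subset_uIcc hx⟩)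
      (by simp) (Eventually.of_forall fun x _ s hs => hasDerivAt_fst (hDr s hs x))).2
    have hflux : ∀ x, HasDerivAt (fun y => -(ρ t y * u t y)) (rt t x) x := by
      intro x
      have h1 := (hasDerivAt_snd (hDr t hmem x)).mul (hasDerivAt_snd (hDu t hmem x))
      have h2 := h.continuity_equation t ht htT x
      have h3 : deriv (fun y => ρ t y * u t y) x = _ := h1.deriv
      rw [(hasDerivAt_fst (hDr t hmem x)).deriv, h3] at h2
      convert! h1.neg using 1
      linarith
    have hint := intervalIntegral.integral_eq_sub_of_hasDerivAt (fun x _ => hflux x)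
      (hrtt.intervalIntegrable a b)
    rw [hint] at hdiff
    convert! hdiff using 1
    ring

end Breakdown

/-! ### Behaviour of the data at infinity -/

section Neutrality

/-- Because the two endpoints move independently, fixing the left one shows that a primitive `M` is
Cauchy at `+∞`; the same limit `ℓ` is then attained at `-∞`, and `M - ℓ` is the field. -/
theorem exists_field_of_neutral {c : ℝ} {ρ₀ : ℝ → ℝ} (hρ₀ : Continuous ρ₀) (h : Neutral c ρ₀) :
    ∃ E₀ : ℝ → ℝ, (∀ x, HasDerivAt E₀ (ρ₀ x - c) x) ∧ Tendsto E₀ atTop (𝓝 0) ∧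
      Tendsto E₀ atBot (𝓝 0) := by
  set M : ℝ → ℝ := fun x => ∫ ξ in (0 : ℝ)..x, (ρ₀ ξ - c)
  have hcont : Continuous fun ξ => ρ₀ ξ - c := hρ₀.sub continuous_const
  have hM : ∀ x, HasDerivAt M (ρ₀ x - c) x := hasDerivAt_integral_of_continuous hcont 0
  have hdiff : Tendsto (fun p : ℝ × ℝ => M p.2 - M p.1) (atBot ×ˢ atTop) (𝓝 0) := by
    refine h.congr fun p => ?_
    exact (intervalIntegral.integral_interval_sub_left (hcont.intervalIntegrable _ _)
      (hcont.intervalIntegrable _ _)).symm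
  have hcauchy : Cauchy (map M atTop) := by
    rw [Metric.cauchy_iff]
    refine ⟨inferInstance, fun ε hε => ?_⟩
    have h1 : ∀ᶠ p : ℝ × ℝ in atBot ×ˢ atTop, |M p.2 - M p.1| < ε / 2 := by
      simpa using hdiff.eventually (Metric.ball_mem_nhds 0 (half_pos hε))
    obtain ⟨pa, hpa, pb, hpb, hp⟩ := eventually_prod_iff.1 h1
    obtain ⟨a, ha⟩ := hpa.exists
    refine ⟨M '' {x | pb x}, image_mem_map hpb, ?_⟩
    rintro _ ⟨x, hx, rfl⟩ _ ⟨y, hy, rfl⟩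
    rw [Real.dist_eq]
    have hx' := abs_lt.1 (hp ha hx)
    have hy' := abs_lt.1 (hp ha hy)
    simp only at hx' hy'
    rw [abs_lt]
    constructor <;> linarith
  obtain ⟨ℓ, hℓ⟩ := CompleteSpace.complete hcauchy
  have hℓ' : Tendsto M atTop (𝓝 ℓ) := hℓ
  have hbot : Tendsto M atBot (𝓝 ℓ) := by
    have h1 : Tendsto (fun p : ℝ × ℝ => M p.2 - (M p.2 - M p.1)) (atBot ×ˢ atTop)
        (𝓝 (ℓ - 0)) := (hℓ'.comp tendsto_snd).sub hdiff
    simp only [sub_sub_cancel, sub_zero] at h1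
    have h2 : map (fun p : ℝ × ℝ => M p.1) (atBot ×ˢ atTop) = map M atBot := by
      rw [show (fun p : ℝ × ℝ => M p.1) = M ∘ Prod.fst from rfl, ← map_map, map_fst_prod]
    rw [Tendsto, h2] at h1
    exact h1
  refine ⟨fun x => M x - ℓ, fun x => (hM x).sub_const ℓ, ?_, ?_⟩
  · simpa using hℓ'.sub_const ℓ
  · simpa using hbot.sub_const ℓ

/-- If the map `α ↦ α + b u₀(α) + g E₀(α)` is monotone, the displacement `b u₀` vanishes at infinity
together with the flux `ρ₀ u₀` and the field `E₀`: every short interval near infinity contains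
points at which the density is bounded below. -/
theorem tendsto_displacement {l : Filter ℝ}
    (hl : ∀ p : ℝ → Prop, (∀ᶠ x in l, p x) → ∀ᶠ x in l, ∀ s ∈ Set.Icc (x - 1) (x + 1), p s)
    {c b g : ℝ} (hc : 0 < c) {ρ₀ u₀ E₀ : ℝ → ℝ} (hE₀ : ∀ x, HasDerivAt E₀ (ρ₀ x - c) x)
    (hlim : Tendsto E₀ l (𝓝 0)) (hflux : Tendsto (fun x => ρ₀ x * u₀ x) l (𝓝 0))
    (hmono : Monotone fun α => α + b * u₀ α + g * E₀ α) :
    Tendsto (fun α => b * u₀ α) l (𝓝 0) := by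
  rw [Metric.tendsto_nhds]
  intro ε' hε'
  obtain ⟨ε, hε, hε1, hεε⟩ : ∃ ε : ℝ, 0 < ε ∧ ε ≤ 1 ∧ 3 * ε < ε' :=
    ⟨min 1 (ε' / 4), by positivity, min_le_left _ _, by
      have := min_le_right 1 (ε' / 4)
      linarith⟩
  have hev : ∀ᶠ x in l, |b * (ρ₀ x * u₀ x)| < ε * (c / 2) ∧ |g * E₀ x| < ε / 2 ∧
      |E₀ x| < c * ε / 4 := by
    have h1 : Tendsto (fun x => |b * (ρ₀ x * u₀ x)|) l (𝓝 0) := by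
      simpa using (hflux.const_mul b).abs
    have h2 : Tendsto (fun x => |g * E₀ x|) l (𝓝 0) := by simpa using (hlim.const_mul g).abs
    have h3 : Tendsto (fun x => |E₀ x|) l (𝓝 0) := by simpa using hlim.abs
    exact (h1.eventually_lt_const (by positivity)).and
      ((h2.eventually_lt_const (by positivity)).and (h3.eventually_lt_const (by positivity)))
  filter_upwards [hl _ hev] with x hx
  -- Across a length `ε` the field changes by less than `c ε/2`, so by the mean value theorem `ρ₀ >
  -- c/2` somewhere; there the small flux bounds `b u₀` itself.
  have hkey : ∀ y z, y < z → z = y + ε → y ∈ Set.Icc (x - 1) (x + 1) →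
      z ∈ Set.Icc (x - 1) (x + 1) →
      ∃ s ∈ Set.Ioo y z, |b * u₀ s| < ε ∧ |g * E₀ s| < ε / 2 := by
    intro y z hyz hzy hy hz
    obtain ⟨s, hs, hsl⟩ := exists_hasDerivAt_eq_slope E₀ (fun x => ρ₀ x - c) hyz
      (fun w _ => (hE₀ w).continuousAt.continuousWithinAt) fun w _ => hE₀ w
    have hsm : s ∈ Set.Icc (x - 1) (x + 1) := ⟨hy.1.trans hs.1.le, hs.2.le.trans hz.2⟩
    refine ⟨s, hs, ?_, (hx s hsm).2.1⟩
    have hyE := abs_lt.1 (hx y hy).2.2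
    have hzE := abs_lt.1 (hx z hz).2.2
    have hzy' : z - y = ε := by linarith
    rw [hzy', eq_div_iff hε.ne'] at hsl
    have hρ : c / 2 < ρ₀ s := by
      by_contra hcon
      have := mul_le_mul_of_nonneg_right (not_lt.1 hcon) hε.le
      nlinarith
    have h1 := (hx s hsm).1
    rw [mul_left_comm, abs_mul, abs_of_pos ((half_pos hc).trans hρ)] at h1
    by_contra hcon
    have h2 := mul_le_mul hρ.le (not_lt.1 hcon) hε.le ((half_pos hc).trans hρ).le
    linarith
  have hxE := abs_lt.1 (hx x ⟨by linarith, by linarith⟩).2.1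
  obtain ⟨s, hs, hsu, hsE⟩ := hkey x (x + ε) (by linarith) rfl ⟨by linarith, by linarith⟩
    ⟨by linarith, by linarith⟩
  obtain ⟨r, hr, hru, hrE⟩ := hkey (x - ε) x (by linarith) (by ring) ⟨by linarith, by linarith⟩
    ⟨by linarith, by linarith⟩
  -- Monotonicity compares `x` with a good point on each side: the distance, `b u₀` there and the
  -- two field terms cost less than `ε + ε + ε/2 + ε/2 = 3ε`.
  have h1 := hmono hs.1.le
  have h2 := hmono hr.2.le
  simp only at h1 h2
  rw [abs_lt] at hsu hsE hru hrE
  rw [Real.dist_eq, sub_zero, abs_lt]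
  constructor
  · linarith [hr.1, hr.2]
  · linarith [hs.1, hs.2]

theorem eventually_forall_Icc_atTop (p : ℝ → Prop) (hp : ∀ᶠ x in atTop, p x) :
    ∀ᶠ x in atTop, ∀ s ∈ Set.Icc (x - 1) (x + 1), p s := by
  obtain ⟨a, ha⟩ := eventually_atTop.1 hp
  filter_upwards [eventually_ge_atTop (a + 1)] with x hx s hs
  exact ha s (by linarith [hs.1])

theorem eventually_forall_Icc_atBot (p : ℝ → Prop) (hp : ∀ᶠ x in atBot, p x) :
    ∀ᶠ x in atBot, ∀ s ∈ Set.Icc (x - 1) (x + 1), p s := by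
  obtain ⟨a, ha⟩ := eventually_atBot.1 hp
  filter_upwards [eventually_le_atBot (a - 1)] with x hx s hs
  exact ha s (by linarith [hs.2])

end Neutrality

/-! ### The global flow and its inverse -/

/-- The characteristic starting at `α`, at the time `t`. -/
def flow (c ν : ℝ) (B B' u₀ E₀ : ℝ → ℝ) (t α : ℝ) : ℝ :=
  α + B t * u₀ α + (1 - B' t - ν * B t) / c * E₀ α

/-- The velocity along the characteristic starting at `α`. -/
def flowVelocity (k : ℝ) (B B' u₀ E₀ : ℝ → ℝ) (t α : ℝ) : ℝ :=
  B' t * u₀ α + k * B t * E₀ α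

/-- Subcritical data together with the inverse `Y` of the flow. -/
structure IsGlobalFlow (c k ν : ℝ) (ρ₀ u₀ B B' E₀ : ℝ → ℝ) (Y : ℝ → ℝ → ℝ) : Prop where
  c_pos : 0 < c
  impulse : IsImpulseResponse c k ν B B'
  density : ContDiff ℝ 1 ρ₀
  velocity : ContDiff ℝ 1 u₀
  field : ∀ x, HasDerivAt E₀ (ρ₀ x - c) x
  stretch_pos : ∀ t, 0 ≤ t → ∀ x, 0 < stretch c ν B B' (ρ₀ x) (deriv u₀ x) t
  flow_inverse : ∀ t, 0 ≤ t → ∀ x, flow c ν B B' u₀ E₀ t (Y t x) = x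

theorem hasDerivAt_flow_snd {c ν : ℝ} {ρ₀ u₀ B B' E₀ : ℝ → ℝ} (hu₀ : Differentiable ℝ u₀)
    (hE₀ : ∀ x, HasDerivAt E₀ (ρ₀ x - c) x) (t α : ℝ) :
    HasDerivAt (flow c ν B B' u₀ E₀ t) (stretch c ν B B' (ρ₀ α) (deriv u₀ α) t) α := by
  exact ((hasDerivAt_id α).add ((hu₀ α).hasDerivAt.const_mul (B t))).add
    ((hE₀ α).const_mul ((1 - B' t - ν * B t) / c))

/-- Positive stretch makes the flow increasing, and then the displacement vanishes at infinity, so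
the flow is asymptotic to the identity and onto. The displacement limits are kept for the decay of
the Eulerian field. -/
theorem exists_isGlobalFlow {c k ν : ℝ} {ρ₀ u₀ B B' E₀ : ℝ → ℝ} (hc : 0 < c)
    (hB : IsImpulseResponse c k ν B B') (hρ₀ : ContDiff ℝ 1 ρ₀) (hu₀ : ContDiff ℝ 1 u₀)
    (hE₀ : ∀ x, HasDerivAt E₀ (ρ₀ x - c) x) (htop : Tendsto E₀ atTop (𝓝 0))
    (hbot : Tendsto E₀ atBot (𝓝 0)) (hflux : VanishingFlux ρ₀ u₀)
    (hpos : ∀ t, 0 ≤ t → ∀ x, 0 < stretch c ν B B' (ρ₀ x) (deriv u₀ x) t) :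
    (∃ Y, IsGlobalFlow c k ν ρ₀ u₀ B B' E₀ Y) ∧
      ∀ t, 0 ≤ t → Tendsto (fun α => B t * u₀ α) atTop (𝓝 0) ∧
        Tendsto (fun α => B t * u₀ α) atBot (𝓝 0) := by
  have hmono : ∀ t, 0 ≤ t → StrictMono (flow c ν B B' u₀ E₀ t) := fun t ht =>
    strictMono_of_hasDerivAt_pos
      (fun α => hasDerivAt_flow_snd (hu₀.differentiable one_ne_zero) hE₀ t α) fun α => hpos t ht α
  have hdisp : ∀ t, 0 ≤ t → Tendsto (fun α => B t * u₀ α) atTop (𝓝 0) ∧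
      Tendsto (fun α => B t * u₀ α) atBot (𝓝 0) := fun t ht =>
    ⟨tendsto_displacement eventually_forall_Icc_atTop hc hE₀ htop hflux.1 (hmono t ht).monotone,
      tendsto_displacement eventually_forall_Icc_atBot hc hE₀ hbot hflux.2 (hmono t ht).monotone⟩
  refine ⟨?_, hdisp⟩
  have hsurj : ∀ t, 0 ≤ t → Function.Surjective (flow c ν B B' u₀ E₀ t) := by
    intro t ht
    refine Continuous.surjective (continuous_iff_continuousAt.2 fun α =>
      (hasDerivAt_flow_snd (hu₀.differentiable one_ne_zero) hE₀ t α).continuousAt) ?_ ?_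
    · exact (tendsto_id.atTop_add (hdisp t ht).1).atTop_add
        (htop.const_mul ((1 - B' t - ν * B t) / c))
    · exact (tendsto_id.atBot_add (hdisp t ht).2).atBot_add
        (hbot.const_mul ((1 - B' t - ν * B t) / c))
  choose! Y hY using fun t ht => hsurj t ht
  exact ⟨Y, hc, hB, hρ₀, hu₀, hE₀, hpos, hY⟩

theorem continuous_of_hasDerivAt {f f' : ℝ → ℝ} (h : ∀ x, HasDerivAt f (f' x) x) :
    Continuous f :=
  continuous_iff_continuousAt.2 fun x => (h x).continuousAt

theorem contDiff_of_hasDerivAt {f f' : ℝ → ℝ} {n : ℕ} (h : ∀ x, HasDerivAt f (f' x) x)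
    (hf' : ContDiff ℝ n f') : ContDiff ℝ (n + 1) f := by
  rw [contDiff_succ_iff_deriv]
  refine ⟨fun x => (h x).differentiableAt, by simp, ?_⟩
  rwa [show deriv f = f' from funext fun x => (h x).deriv]

namespace IsGlobalFlow

variable {c k ν : ℝ} {ρ₀ u₀ B B' E₀ : ℝ → ℝ} {Y : ℝ → ℝ → ℝ}

theorem contDiff_impulse (h : IsGlobalFlow c k ν ρ₀ u₀ B B' E₀ Y) : ContDiff ℝ 1 B :=
  contDiff_of_hasDerivAt (n := 0) h.impulse.hasDerivAt
    (contDiff_zero.2 (continuous_of_hasDerivAt h.impulse.hasDerivAt_deriv))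

theorem contDiff_impulse_deriv (h : IsGlobalFlow c k ν ρ₀ u₀ B B' E₀ Y) : ContDiff ℝ 1 B' :=
  contDiff_of_hasDerivAt (n := 0) h.impulse.hasDerivAt_deriv (contDiff_zero.2
    ((continuous_const.mul (continuous_of_hasDerivAt h.impulse.hasDerivAt_deriv)).sub
      (continuous_const.mul (continuous_of_hasDerivAt h.impulse.hasDerivAt))))

theorem contDiff_field (h : IsGlobalFlow c k ν ρ₀ u₀ B B' E₀ Y) : ContDiff ℝ 1 E₀ :=
  contDiff_of_hasDerivAt (n := 0) h.field
    (contDiff_zero.2 (h.density.continuous.sub continuous_const))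

theorem contDiff_flow (h : IsGlobalFlow c k ν ρ₀ u₀ B B' E₀ Y) :
    ContDiff ℝ 1 (fun p : ℝ × ℝ => flow c ν B B' u₀ E₀ p.1 p.2) := by
  have h1 := h.contDiff_impulse
  have h2 := h.contDiff_impulse_deriv
  have h3 := h.contDiff_field
  have h4 := h.velocity
  unfold flow
  fun_prop

theorem contDiff_flowVelocity (h : IsGlobalFlow c k ν ρ₀ u₀ B B' E₀ Y) :
    ContDiff ℝ 1 (fun p : ℝ × ℝ => flowVelocity k B B' u₀ E₀ p.1 p.2) := by
  have h1 := h.contDiff_impulse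
  have h2 := h.contDiff_impulse_deriv
  have h3 := h.contDiff_field
  have h4 := h.velocity
  unfold flowVelocity
  fun_prop

theorem hasDerivAt_flow_fst (h : IsGlobalFlow c k ν ρ₀ u₀ B B' E₀ Y) (t α : ℝ) :
    HasDerivAt (fun s => flow c ν B B' u₀ E₀ s α) (flowVelocity k B B' u₀ E₀ t α) t :=
  (((h.impulse.hasDerivAt t).mul_const (u₀ α)).const_add α).add
    ((h.impulse.hasDerivAt_gain h.c_pos.ne' t).mul_const (E₀ α))

theorem hasDerivAt_flow_snd (h : IsGlobalFlow c k ν ρ₀ u₀ B B' E₀ Y) (t α : ℝ) :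
    HasDerivAt (flow c ν B B' u₀ E₀ t) (stretch c ν B B' (ρ₀ α) (deriv u₀ α) t) α :=
  EulerPoisson.hasDerivAt_flow_snd (h.velocity.differentiable one_ne_zero) h.field t α

theorem hasFDerivAt_flow (h : IsGlobalFlow c k ν ρ₀ u₀ B B' E₀ Y) (t α : ℝ) :
    HasFDerivAt (fun p : ℝ × ℝ => flow c ν B B' u₀ E₀ p.1 p.2)
      ((ContinuousLinearMap.fst ℝ ℝ ℝ).smulRight (flowVelocity k B B' u₀ E₀ t α) +
        (ContinuousLinearMap.snd ℝ ℝ ℝ).smulRight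
          (stretch c ν B B' (ρ₀ α) (deriv u₀ α) t)) (t, α) :=
  hasFDerivAt_of_partials (h.contDiff_flow.differentiable one_ne_zero (t, α))
    (h.hasDerivAt_flow_fst t α) (h.hasDerivAt_flow_snd t α)

theorem flow_strictMono (h : IsGlobalFlow c k ν ρ₀ u₀ B B' E₀ Y) {t : ℝ} (ht : 0 ≤ t) :
    StrictMono (flow c ν B B' u₀ E₀ t) :=
  strictMono_of_hasDerivAt_pos (h.hasDerivAt_flow_snd t) (h.stretch_pos t ht)

theorem inverse_flow (h : IsGlobalFlow c k ν ρ₀ u₀ B B' E₀ Y) {t : ℝ} (ht : 0 ≤ t) (α : ℝ) :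
    Y t (flow c ν B B' u₀ E₀ t α) = α :=
  (h.flow_strictMono ht).injective (h.flow_inverse t ht _)

theorem inverse_zero (h : IsGlobalFlow c k ν ρ₀ u₀ B B' E₀ Y) (x : ℝ) : Y 0 x = x := by
  have := h.flow_inverse 0 le_rfl x
  simpa [flow, h.impulse.apply_zero, h.impulse.deriv_zero] using this

theorem inverse_strictMono (h : IsGlobalFlow c k ν ρ₀ u₀ B B' E₀ Y) {t : ℝ} (ht : 0 ≤ t) :
    StrictMono (Y t) := fun x y hxy => by
  rw [← (h.flow_strictMono ht).lt_iff_lt, h.flow_inverse t ht, h.flow_inverse t ht]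
  exact hxy

theorem tendsto_inverse_atTop (h : IsGlobalFlow c k ν ρ₀ u₀ B B' E₀ Y) {t : ℝ} (ht : 0 ≤ t) :
    Tendsto (Y t) atTop atTop :=
  (h.inverse_strictMono ht).monotone.tendsto_atTop_atTop fun b =>
    ⟨_, (h.inverse_flow ht b).ge⟩

theorem tendsto_inverse_atBot (h : IsGlobalFlow c k ν ρ₀ u₀ B B' E₀ Y) {t : ℝ} (ht : 0 ≤ t) :
    Tendsto (Y t) atBot atBot :=
  (h.inverse_strictMono ht).monotone.tendsto_atBot_atBot fun b =>
    ⟨_, (h.inverse_flow ht b).le⟩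

/-- Inverse function theorem for `(t, α) ↦ (t, X(t, α))`, whose derivative is triangular with
diagonal `1, Γ`. The flow is defined for all real times, so this also works at `t = 0`; injectivity
identifies the local inverse with `Y` for `t ≥ 0`. -/
theorem contDiffOn_inverse (h : IsGlobalFlow c k ν ρ₀ u₀ B B' E₀ Y) :
    ContDiffOn ℝ 1 (fun p : ℝ × ℝ => Y p.1 p.2) (slab ⊤) := by
  rintro ⟨t, x⟩ ⟨ht, -⟩
  simp only at ht
  set α := Y t x
  set Φ : ℝ × ℝ → ℝ × ℝ := fun p => (p.1, flow c ν B B' u₀ E₀ p.1 p.2) with hΦ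
  set W := flowVelocity k B B' u₀ E₀ t α
  set Γ := stretch c ν B B' (ρ₀ α) (deriv u₀ α) t
  have hΓ : Γ ≠ 0 := (h.stretch_pos t ht α).ne'
  set L : (ℝ × ℝ) ≃L[ℝ] (ℝ × ℝ) := ContinuousLinearEquiv.equivOfInverse
    ((ContinuousLinearMap.fst ℝ ℝ ℝ).prod ((ContinuousLinearMap.fst ℝ ℝ ℝ).smulRight W +
      (ContinuousLinearMap.snd ℝ ℝ ℝ).smulRight Γ))
    ((ContinuousLinearMap.fst ℝ ℝ ℝ).prod ((ContinuousLinearMap.fst ℝ ℝ ℝ).smulRight (-(W / Γ)) +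
      (ContinuousLinearMap.snd ℝ ℝ ℝ).smulRight Γ⁻¹))
    (fun p => by
      ext
      · simp
      · simp
        field_simp
        ring)
    (fun p => by
      ext
      · simp
      · simp
        field_simp
        ring)
  have hΦC : ContDiffAt ℝ 1 Φ (t, α) := (contDiff_fst.prodMk h.contDiff_flow).contDiffAt
  have hΦD : HasFDerivAt Φ (L : (ℝ × ℝ) →L[ℝ] (ℝ × ℝ)) (t, α) :=
    hasFDerivAt_fst.prodMk (h.hasFDerivAt_flow t α)
  have hΦp : Φ (t, α) = (t, x) := by simp [hΦ, α, h.flow_inverse t ht]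
  have hψC := hΦC.to_localInverse hΦD one_ne_zero
  have hψ := (hΦC.hasStrictFDerivAt' hΦD one_ne_zero).eventually_right_inverse
  rw [hΦp] at hψC hψ
  refine (hψC.snd.contDiffWithinAt (s := slab ⊤)).congr_of_eventuallyEq_of_mem ?_
    ⟨ht, by simp⟩
  filter_upwards [nhdsWithin_le_nhds hψ, self_mem_nhdsWithin] with p hp hps
  change Φ (hΦC.localInverse hΦD one_ne_zero p) = p at hp
  have h1 : (hΦC.localInverse hΦD one_ne_zero p).1 = p.1 := (Prod.ext_iff.1 hp).1
  have h2 : flow c ν B B' u₀ E₀ (hΦC.localInverse hΦD one_ne_zero p).1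
    (hΦC.localInverse hΦD one_ne_zero p).2 = p.2 := (Prod.ext_iff.1 hp).2
  rw [h1] at h2
  rw [← h.inverse_flow hps.1 (hΦC.localInverse hΦD one_ne_zero p).2, h2]

theorem slab_mem_nhds {t : ℝ} (ht : 0 < t) (x : ℝ) : slab ⊤ ∈ 𝓝 (t, x) := by
  filter_upwards [prod_mem_nhds (Ioi_mem_nhds ht) univ_mem] with p hp
  exact ⟨(Set.mem_Ioi.1 hp.1).le, by simp⟩

theorem hasFDerivAt_inverse (h : IsGlobalFlow c k ν ρ₀ u₀ B B' E₀ Y) {t : ℝ} (ht : 0 < t)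
    (x : ℝ) :
    HasFDerivAt (fun p : ℝ × ℝ => Y p.1 p.2)
      ((ContinuousLinearMap.fst ℝ ℝ ℝ).smulRight (-(flowVelocity k B B' u₀ E₀ t (Y t x) /
          stretch c ν B B' (ρ₀ (Y t x)) (deriv u₀ (Y t x)) t)) +
        (ContinuousLinearMap.snd ℝ ℝ ℝ).smulRight
          (stretch c ν B B' (ρ₀ (Y t x)) (deriv u₀ (Y t x)) t)⁻¹) (t, x) := by
  have hΓ := (h.stretch_pos t ht.le (Y t x)).ne'
  have hd := ((h.contDiffOn_inverse.contDiffAt (slab_mem_nhds ht x)).differentiableAt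
    one_ne_zero).hasFDerivAt
  have h1 := hd.comp_hasDerivAt t ((hasDerivAt_id t).prodMk (hasDerivAt_const t x))
  have h2 := hd.comp_hasDerivAt x ((hasDerivAt_const x t).prodMk (hasDerivAt_id x))
  have e1 := hasDerivAt_comp_path (f := flow c ν B B' u₀ E₀) (h.hasFDerivAt_flow t (Y t x)) h1 rfl
  have e2 := (h.hasDerivAt_flow_snd t (Y t x)).comp x h2
  have e1' := (e1.congr_of_eventuallyEq (f₁ := fun _ => x) (by
    filter_upwards [Ioi_mem_nhds ht] with s hs
    exact (h.flow_inverse s (Set.mem_Ioi.1 hs).le x).symm)).unique (hasDerivAt_const t x)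
  have e2' := (e2.congr_of_eventuallyEq (f₁ := fun y => y) (Eventually.of_forall fun y =>
    (h.flow_inverse t ht.le y).symm)).unique (hasDerivAt_id x)
  have hft : -(flowVelocity k B B' u₀ E₀ t (Y t x) /
      stretch c ν B B' (ρ₀ (Y t x)) (deriv u₀ (Y t x)) t) =
        fderiv ℝ (fun p : ℝ × ℝ => Y p.1 p.2) (t, x) (1, 0) := by
    field_simp
    linarith
  have hfx : (stretch c ν B B' (ρ₀ (Y t x)) (deriv u₀ (Y t x)) t)⁻¹ =
      fderiv ℝ (fun p : ℝ × ℝ => Y p.1 p.2) (t, x) (0, 1) := by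
    field_simp
    linarith
  rw [hft, hfx]
  exact hasFDerivAt_of_partials hd.differentiableAt h1 h2

theorem hasDerivAt_inverse_snd (h : IsGlobalFlow c k ν ρ₀ u₀ B B' E₀ Y) {t : ℝ} (ht : 0 < t)
    (x : ℝ) :
    HasDerivAt (Y t) (stretch c ν B B' (ρ₀ (Y t x)) (deriv u₀ (Y t x)) t)⁻¹ x :=
  hasDerivAt_snd (f := Y) (h.hasFDerivAt_inverse ht x)

theorem hasDerivAt_inverse_fst (h : IsGlobalFlow c k ν ρ₀ u₀ B B' E₀ Y) {t : ℝ} (ht : 0 < t)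
    (x : ℝ) :
    HasDerivAt (fun s => Y s x) (-(flowVelocity k B B' u₀ E₀ t (Y t x) /
      stretch c ν B B' (ρ₀ (Y t x)) (deriv u₀ (Y t x)) t)) t :=
  hasDerivAt_fst (f := Y) (h.hasFDerivAt_inverse ht x)

end IsGlobalFlow

/-! ### The Eulerian solution -/

namespace IsGlobalFlow

variable {c k ν : ℝ} {ρ₀ u₀ B B' E₀ : ℝ → ℝ} {Y : ℝ → ℝ → ℝ}

/-- The Eulerian velocity of the flow. -/
def eulerVelocity (k : ℝ) (u₀ B B' E₀ : ℝ → ℝ) (Y : ℝ → ℝ → ℝ) (t x : ℝ) : ℝ :=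
  flowVelocity k B B' u₀ E₀ t (Y t x)

/-- The Eulerian density of the flow. -/
def eulerDensity (c ν : ℝ) (ρ₀ u₀ B B' : ℝ → ℝ) (Y : ℝ → ℝ → ℝ) (t x : ℝ) : ℝ :=
  ρ₀ (Y t x) / stretch c ν B B' (ρ₀ (Y t x)) (deriv u₀ (Y t x)) t

/-- The Eulerian electric field of the flow. -/
def eulerField (c : ℝ) (E₀ : ℝ → ℝ) (Y : ℝ → ℝ → ℝ) (t x : ℝ) : ℝ :=
  E₀ (Y t x) + c * (Y t x - x)

theorem contDiffOn_velocity (h : IsGlobalFlow c k ν ρ₀ u₀ B B' E₀ Y) :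
    ContDiffOn ℝ 1 (fun p : ℝ × ℝ => eulerVelocity k u₀ B B' E₀ Y p.1 p.2) (slab ⊤) :=
  h.contDiff_flowVelocity.comp_contDiffOn (contDiffOn_fst.prodMk h.contDiffOn_inverse)

theorem hasDerivAt_eulerField (h : IsGlobalFlow c k ν ρ₀ u₀ B B' E₀ Y) {t : ℝ} (ht : 0 < t)
    (x : ℝ) :
    HasDerivAt (eulerField c E₀ Y t) (eulerDensity c ν ρ₀ u₀ B B' Y t x - c) x := by
  have hY := h.hasDerivAt_inverse_snd ht x
  convert! ((h.field (Y t x)).comp x hY).add ((hY.sub (hasDerivAt_id x)).const_mul c) using 1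
  simp only [eulerDensity]
  ring

theorem continuousOn_density (h : IsGlobalFlow c k ν ρ₀ u₀ B B' E₀ Y) :
    ContinuousOn (fun p : ℝ × ℝ => eulerDensity c ν ρ₀ u₀ B B' Y p.1 p.2) (slab ⊤) := by
  have hY := h.contDiffOn_inverse.continuousOn
  have hB := h.contDiff_impulse.continuous
  have hB' := h.contDiff_impulse_deriv.continuous
  have hρ := h.density.continuous
  have hu := h.velocity.continuous_deriv le_rfl
  refine ContinuousOn.div (hρ.comp_continuousOn hY) ?_ fun p hp =>
    (h.stretch_pos p.1 hp.1 (Y p.1 p.2)).ne'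
  have : Continuous fun q : ℝ × ℝ => stretch c ν B B' (ρ₀ q.2) (deriv u₀ q.2) q.1 := by
    unfold stretch
    fun_prop
  exact this.comp_continuousOn (continuousOn_fst.prodMk hY)

theorem contDiffOn_density (h : IsGlobalFlow c k ν ρ₀ u₀ B B' E₀ Y) (hu₀ : ContDiff ℝ 2 u₀) :
    ContDiffOn ℝ 1 (fun p : ℝ × ℝ => eulerDensity c ν ρ₀ u₀ B B' Y p.1 p.2) (slab ⊤) := by
  have hY := h.contDiffOn_inverse
  have hB := h.contDiff_impulse
  have hB' := h.contDiff_impulse_deriv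
  have hρ := h.density
  have hu : ContDiff ℝ 1 (deriv u₀) := by
    rw [← one_add_one_eq_two] at hu₀
    exact (contDiff_succ_iff_deriv.1 hu₀).2.2
  refine ContDiffOn.div (hρ.comp_contDiffOn hY) ?_ fun p hp =>
    (h.stretch_pos p.1 hp.1 (Y p.1 p.2)).ne'
  have : ContDiff ℝ 1 fun q : ℝ × ℝ => stretch c ν B B' (ρ₀ q.2) (deriv u₀ q.2) q.1 := by
    unfold stretch
    fun_prop
  exact this.comp_contDiffOn (contDiffOn_fst.prodMk hY)

theorem continuous_density_slice (h : IsGlobalFlow c k ν ρ₀ u₀ B B' E₀ Y) {t : ℝ} (ht : 0 < t) :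
    Continuous (eulerDensity c ν ρ₀ u₀ B B' Y t) :=
  h.continuousOn_density.comp_continuous (f := fun x : ℝ => (t, x)) (by fun_prop) fun _ =>
    ⟨ht.le, by simp⟩

theorem hasDerivAt_flowVelocity_fst (h : IsGlobalFlow c k ν ρ₀ u₀ B B' E₀ Y) (t α : ℝ) :
    HasDerivAt (fun s => flowVelocity k B B' u₀ E₀ s α)
      (k * (E₀ α + c * (α - flow c ν B B' u₀ E₀ t α)) - ν * flowVelocity k B B' u₀ E₀ t α) t := by
  have hc := h.c_pos.ne'
  convert! ((h.impulse.hasDerivAt_deriv t).mul_const (u₀ α)).add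
    (((h.impulse.hasDerivAt t).const_mul k).mul_const (E₀ α)) using 1
  simp only [flow, flowVelocity]
  field_simp
  ring

theorem hasDerivAt_flowVelocity_snd (h : IsGlobalFlow c k ν ρ₀ u₀ B B' E₀ Y) (t α : ℝ) :
    HasDerivAt (flowVelocity k B B' u₀ E₀ t)
      (B' t * deriv u₀ α + k * B t * (ρ₀ α - c)) α :=
  ((h.velocity.differentiable one_ne_zero α).hasDerivAt.const_mul (B' t)).add
    ((h.field α).const_mul (k * B t))

/-- The left side is the derivative of `u` along the characteristic through `(t, x)`, where the
oscillator equation evaluates it. -/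
theorem momentum_equation (h : IsGlobalFlow c k ν ρ₀ u₀ B B' E₀ Y) {t : ℝ} (ht : 0 < t)
    (x : ℝ) :
    deriv (fun s => eulerVelocity k u₀ B B' E₀ Y s x) t +
      eulerVelocity k u₀ B B' E₀ Y t x * deriv (fun y => eulerVelocity k u₀ B B' E₀ Y t y) x =
        k * eulerField c E₀ Y t x - ν * eulerVelocity k u₀ B B' E₀ Y t x := by
  have hd := (h.contDiffOn_velocity.contDiffAt (slab_mem_nhds ht x)).differentiableAt one_ne_zero
  have ht' : DifferentiableAt ℝ (fun s => eulerVelocity k u₀ B B' E₀ Y s x) t :=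
    hd.comp (f := fun s : ℝ => (s, x)) t (by fun_prop)
  have hx' : DifferentiableAt ℝ (fun y => eulerVelocity k u₀ B B' E₀ Y t y) x :=
    hd.comp (f := fun y : ℝ => (t, y)) x (by fun_prop)
  have hF := hasFDerivAt_of_partials (f := eulerVelocity k u₀ B B' E₀ Y) hd
    ht'.hasDerivAt hx'.hasDerivAt
  have h1 := hasDerivAt_comp_path (f := eulerVelocity k u₀ B B' E₀ Y) hF
    (h.hasDerivAt_flow_fst t (Y t x)) (h.flow_inverse t ht.le x)
  have h2 := (h.hasDerivAt_flowVelocity_fst t (Y t x)).congr_of_eventuallyEq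
    (f₁ := fun s => eulerVelocity k u₀ B B' E₀ Y s (flow c ν B B' u₀ E₀ s (Y t x))) (by
      filter_upwards [Ioi_mem_nhds ht] with s hs
      rw [eulerVelocity, h.inverse_flow (Set.mem_Ioi.1 hs).le])
  have h3 := h1.unique h2
  rw [h.flow_inverse t ht.le] at h3
  exact h3

/-- `E₀(Y) + c Y` is a primitive of the density in `x` and has time derivative `-ρu`, so no
derivative of `ρ` is needed. -/
theorem mass_balance (h : IsGlobalFlow c k ν ρ₀ u₀ B B' E₀ Y) {t : ℝ} (ht : 0 < t) (a b : ℝ) :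
    HasDerivAt (fun s => ∫ x in a..b, eulerDensity c ν ρ₀ u₀ B B' Y s x)
      (eulerDensity c ν ρ₀ u₀ B B' Y t a * eulerVelocity k u₀ B B' E₀ Y t a -
        eulerDensity c ν ρ₀ u₀ B B' Y t b * eulerVelocity k u₀ B B' E₀ Y t b) t := by
  have hS : ∀ x, HasDerivAt (fun s => E₀ (Y s x) + c * Y s x)
      (-(eulerDensity c ν ρ₀ u₀ B B' Y t x * eulerVelocity k u₀ B B' E₀ Y t x)) t := by
    intro x
    have hY := h.hasDerivAt_inverse_fst ht x
    convert! ((h.field (Y t x)).comp t hY).add (hY.const_mul c) using 1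
    simp only [eulerDensity, eulerVelocity]
    ring
  have heq : ∀ s, 0 < s → ∫ x in a..b, eulerDensity c ν ρ₀ u₀ B B' Y s x =
      (E₀ (Y s b) + c * Y s b) - (E₀ (Y s a) + c * Y s a) := by
    intro s hs
    refine intervalIntegral.integral_eq_sub_of_hasDerivAt (f := fun x => E₀ (Y s x) + c * Y s x)
      (fun x _ => ?_) ((h.continuous_density_slice hs).intervalIntegrable a b)
    have hY := h.hasDerivAt_inverse_snd hs x
    convert! ((h.field (Y s x)).comp x hY).add (hY.const_mul c) using 1
    simp only [eulerDensity]
    ring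
  have := (hS b).sub (hS a)
  refine (this.congr_of_eventuallyEq ?_).congr_deriv (by ring)
  filter_upwards [Ioi_mem_nhds ht] with s hs
  exact heq s hs

/-- The product `ρ Γ` keeps the value `ρ₀(α)` along a characteristic, while `u_x = Γ'/Γ`. -/
theorem continuity_equation (h : IsGlobalFlow c k ν ρ₀ u₀ B B' E₀ Y) (hu₀ : ContDiff ℝ 2 u₀)
    {t : ℝ} (ht : 0 < t) (x : ℝ) :
    deriv (fun s => eulerDensity c ν ρ₀ u₀ B B' Y s x) t +
      deriv (fun y => eulerDensity c ν ρ₀ u₀ B B' Y t y * eulerVelocity k u₀ B B' E₀ Y t y) x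
        = 0 := by
  have hd := ((h.contDiffOn_density hu₀).contDiffAt (slab_mem_nhds ht x)).differentiableAt
    one_ne_zero
  have ht' : DifferentiableAt ℝ (fun s => eulerDensity c ν ρ₀ u₀ B B' Y s x) t :=
    hd.comp (f := fun s : ℝ => (s, x)) t (by fun_prop)
  have hx' : DifferentiableAt ℝ (fun y => eulerDensity c ν ρ₀ u₀ B B' Y t y) x :=
    hd.comp (f := fun y : ℝ => (t, y)) x (by fun_prop)
  have hF := hasFDerivAt_of_partials (f := eulerDensity c ν ρ₀ u₀ B B' Y) hd
    ht'.hasDerivAt hx'.hasDerivAt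
  set α := Y t x
  have hX : flow c ν B B' u₀ E₀ t α = x := h.flow_inverse t ht.le x
  have hΓ := h.stretch_pos t ht.le α
  have h1 := (hasDerivAt_comp_path (f := eulerDensity c ν ρ₀ u₀ B B' Y) hF
    (h.hasDerivAt_flow_fst t α) hX).mul
      (h.impulse.hasDerivAt_stretch h.c_pos.ne' (ρ₀ α) (deriv u₀ α) t)
  have h2 := (h1.congr_of_eventuallyEq (f₁ := fun _ => ρ₀ α) (by
    filter_upwards [Ioi_mem_nhds ht] with s hs
    have hs' := (Set.mem_Ioi.1 hs).le
    have := (h.stretch_pos s hs' α).ne'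
    simp only [Pi.mul_apply, eulerDensity, h.inverse_flow hs']
    field_simp)).unique (hasDerivAt_const t (ρ₀ α))
  have h3 : HasDerivAt (fun y => eulerVelocity k u₀ B B' E₀ Y t y)
      ((B' t * deriv u₀ α + k * B t * (ρ₀ α - c)) *
        (stretch c ν B B' (ρ₀ α) (deriv u₀ α) t)⁻¹) x :=
    (h.hasDerivAt_flowVelocity_snd t α).comp x (h.hasDerivAt_inverse_snd ht x)
  have h4 : deriv (fun y => eulerDensity c ν ρ₀ u₀ B B' Y t y * eulerVelocity k u₀ B B' E₀ Y t y)
      x = _ := (hx'.hasDerivAt.mul h3).deriv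
  rw [h4]
  rw [hX] at h2
  have hv : eulerVelocity k u₀ B B' E₀ Y t x = flowVelocity k B B' u₀ E₀ t α := rfl
  rw [hv]
  refine (mul_eq_zero_iff_right hΓ.ne').1 ?_
  rw [← h2]
  field_simp
  ring

theorem isMomentumSolution (h : IsGlobalFlow c k ν ρ₀ u₀ B B' E₀ Y)
    (htop : Tendsto E₀ atTop (𝓝 0)) (hbot : Tendsto E₀ atBot (𝓝 0))
    (hdisp : ∀ t, 0 ≤ t → Tendsto (fun α => B t * u₀ α) atTop (𝓝 0) ∧
      Tendsto (fun α => B t * u₀ α) atBot (𝓝 0)) :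
    IsMomentumSolution c k ν ρ₀ u₀ ⊤ (eulerDensity c ν ρ₀ u₀ B B' Y)
      (eulerVelocity k u₀ B B' E₀ Y) where
  velocity_contDiffOn := h.contDiffOn_velocity
  initial_density x := by
    rw [eulerDensity, h.inverse_zero, h.impulse.stretch_zero, div_one]
  initial_velocity x := by
    simp [eulerVelocity, flowVelocity, h.inverse_zero, h.impulse.apply_zero, h.impulse.deriv_zero]
  exists_potential := by
    refine ⟨fun t x => ∫ y in (0 : ℝ)..x, -eulerField c E₀ Y t y, fun t ht _ => ?_⟩
    have hE := h.hasDerivAt_eulerField ht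
    have hφ : ∀ x, HasDerivAt (fun x => ∫ y in (0 : ℝ)..x, -eulerField c E₀ Y t y)
        (-eulerField c E₀ Y t x) x :=
      hasDerivAt_integral_of_continuous (continuous_of_hasDerivAt hE).neg 0
    have hφ' : deriv (fun x => ∫ y in (0 : ℝ)..x, -eulerField c E₀ Y t y) =
        fun x => -eulerField c E₀ Y t x := funext fun x => (hφ x).deriv
    -- Substituting `x = X(t, Y)` turns the field into `E₀` minus `c` times the displacement, both
    -- evaluated at `Y`.
    have hlim : ∀ l : Filter ℝ, Tendsto (Y t) l l → Tendsto E₀ l (𝓝 0) →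
        Tendsto (fun α => B t * u₀ α) l (𝓝 0) →
        Tendsto (fun x => -eulerField c E₀ Y t x) l (𝓝 0) := by
      intro l hY h1 h2
      have h3 : Tendsto (fun α => c * (B t * u₀ α + (1 - B' t - ν * B t) / c * E₀ α) - E₀ α) l
          (𝓝 0) := by
        simpa using ((h2.add (h1.const_mul ((1 - B' t - ν * B t) / c))).const_mul c).sub h1
      refine (h3.comp hY).congr fun x => ?_
      have h4 := h.flow_inverse t ht.le x
      simp only [flow] at h4
      simp only [Function.comp, eulerField]
      linear_combination c * h4
    have hE1 : ContDiff ℝ 1 (fun x => -eulerField c E₀ Y t x) :=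
      contDiff_of_hasDerivAt (n := 0) (fun x => (hE x).neg)
        (contDiff_zero.2 ((h.continuous_density_slice ht).sub continuous_const).neg)
    refine ⟨?_, ?_, ?_, fun x => ⟨?_, ?_⟩⟩
    · have := contDiff_of_hasDerivAt (n := 1) hφ hE1
      rwa [Nat.cast_one, one_add_one_eq_two] at this
    · rw [hφ']
      exact hlim _ (h.tendsto_inverse_atTop ht.le) htop (hdisp t ht.le).1
    · rw [hφ']
      exact hlim _ (h.tendsto_inverse_atBot ht.le) hbot (hdisp t ht.le).2
    · have h5 : deriv (fun x => -eulerField c E₀ Y t x) x = _ := (hE x).neg.deriv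
      rw [hφ', h5, neg_neg]
    · rw [hφ', h.momentum_equation ht x]
      ring

end IsGlobalFlow

end

end EulerPoisson

theorem theorem2p2 (c k ν : ℝ) (hc : 0 < c) (hk : 0 < k) (hν : 0 < ν)
    (ρ₀ u₀ : ℝ → ℝ) (hρ₀ : ContDiff ℝ 1 ρ₀) (hρ₀_pos : ∀ x, 0 < ρ₀ x) (hu₀ : ContDiff ℝ 1 u₀)
    (hneutral : EulerPoisson.Neutral c ρ₀) (hflux : EulerPoisson.VanishingFlux ρ₀ u₀) :
    (EulerPoisson.continuousLifespan c k ν ρ₀ u₀ < ⊤ ↔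
      ∃ x : ℝ, EulerPoisson.Supercritical c k ν (ρ₀ x) (deriv u₀ x)) ∧
    (ContDiff ℝ 2 u₀ →
      (EulerPoisson.classicalLifespan c k ν ρ₀ u₀ < ⊤ ↔
        ∃ x : ℝ, EulerPoisson.Supercritical c k ν (ρ₀ x) (deriv u₀ x))) := by
  open EulerPoisson in
  obtain ⟨B, B', hB, hcrit⟩ := exists_impulseResponse hc hk hν
  have hbreak : (∃ x : ℝ, Supercritical c k ν (ρ₀ x) (deriv u₀ x)) →
      continuousLifespan c k ν ρ₀ u₀ < ⊤ := by
    rintro ⟨x, hx⟩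
    obtain ⟨t, ht, hs⟩ := (hcrit _ _ (hρ₀_pos x)).2 hx
    refine lt_of_le_of_lt (sSup_le ?_) (ENNReal.ofReal_lt_top (r := t))
    rintro T ⟨ρ, u, h⟩
    exact h.le_of_stretch_nonpos hc.ne' hk.ne' hB (hu₀.differentiable one_ne_zero) ht hs
  have hle : classicalLifespan c k ν ρ₀ u₀ ≤ continuousLifespan c k ν ρ₀ u₀ :=
    sSup_le_sSup fun T ⟨ρ, u, h⟩ => ⟨ρ, u, h.isContinuousSolution⟩
  have hglobal : (¬∃ x : ℝ, Supercritical c k ν (ρ₀ x) (deriv u₀ x)) →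
      continuousLifespan c k ν ρ₀ u₀ = ⊤ ∧
        (ContDiff ℝ 2 u₀ → classicalLifespan c k ν ρ₀ u₀ = ⊤) := by
    intro hsub
    obtain ⟨E₀, hE₀, htop, hbot⟩ := exists_field_of_neutral hρ₀.continuous hneutral
    have hpos : ∀ t, 0 ≤ t → ∀ x, 0 < stretch c ν B B' (ρ₀ x) (deriv u₀ x) t := by
      intro t ht x
      by_contra hcon
      exact hsub ⟨x, (hcrit _ _ (hρ₀_pos x)).1 ⟨t, ht, not_lt.1 hcon⟩⟩
    obtain ⟨⟨Y, hY⟩, hdisp⟩ := exists_isGlobalFlow hc hB hρ₀ hu₀ hE₀ htop hbot hflux hpos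
    have hmom := hY.isMomentumSolution htop hbot hdisp
    refine ⟨top_le_iff.1 (le_sSup ⟨_, _, hmom, hY.continuousOn_density, fun t ht _ a b _ =>
      hY.mass_balance ht a b⟩), fun hu₀' => top_le_iff.1 (le_sSup ⟨_, _, hmom,
        hY.contDiffOn_density hu₀', fun t ht _ x => hY.continuity_equation hu₀' ht x⟩)⟩
  refine ⟨⟨fun hlt => ?_, hbreak⟩, fun hu₀' => ⟨fun hlt => ?_, fun hx => hle.trans_lt (hbreak hx)⟩⟩
  · by_contra hcon
    exact hlt.ne (hglobal hcon).1
  · by_contra hcon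
    exact hlt.ne ((hglobal hcon).2 hu₀')
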